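/- Let $\Omega\subset\mathbb{R}^N$ be a non-empty open set and $p\in(1,\infty)$, $1/p+1/p'=1$. Let $W^{1,p}(\Omega)$ be the space of $u\in L^p(\Omega)$ with weak partial derivatives $\partial_i u\in L^p(\Omega)$, normed by $\|u\|^p=\|u\|_{L^p(\Omega)}^p+\sum_{i=1}^N\|\partial_i u\|_{L^p(\Omega)}^p$, and let $\tilde W^{1,p}(\Omega)$ be the closure in $W^{1,p}(\Omega)$ of $W^{1,p}(\Omega)\cap C_c(\overline\Omega)=\{v|_\Omega : v\in C_c(\overline\Omega),\ v|_\Omega\in W^{1,p}(\Omega)\}$. For $A\subset\overline\Omega$ the relative capacity is $$\mathrm{Cap}_{p,\Omega}(A)=\inf\{\|u\|^p : u\in\tilde W^{1,p}(\Omega),\ u\ge 1 \text{ a.e. on } O\cap\Omega \text{ for some } O\supset A \text{ open in } \overline\Omega\}\in[0,\infty].$$ A property holds quasi everywhere (q.e.) if it holds outside a set $P\subset\overline\Omega$ with $\mathrm{Cap}_{p,\Omega}(P)=0$. A function $f:\overline\Omega\to\mathbb{R}$ is quasi continuous if for every $\varepsilon>0$ there is a set $V$ open in $\overline\Omega$ with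 $\mathrm{Cap}_{p,\Omega}(V)<\varepsilon$ such that $f|_{\overline\Omega\setminus V}$ is continuous. The refined Sobolev space $\mathcal{W}^{1,p}(\Omega)$ consists of the classes, modulo equality q.e., of the quasi continuous functions on $\overline\Omega$ that coincide a.e. on $\Omega$ with an element of $\tilde W^{1,p}(\Omega)$; it carries the linear structure and norm of $\tilde W^{1,p}(\Omega)$ (each class being identified with the element of $\tilde W^{1,p}(\Omega)$ given by its representatives), and $\mathcal{W}^{1,p}(\Omega)'$ is its topological dual with the operator norm. A capacitary extremal for $A$ is a $u\in\mathcal{W}^{1,p}(\Omega)$ with $u\ge1$ q.e. on $A$ and $\|u\|^p=\mathrm{Cap}_{p,\Omega}(A)$. A potential of $\Phi\in\mathcal{W}^{1,p}(\Omega)'$ is a minimizer of $v\mapsto\frac1p\|v\|^p-\Phi(v)$ on $\mathcal{W}^{1,p}(\Omega)$. A Radon measure on $\overline\Omega$ is an inner regular, locally finite Borel measure; such a measure $\mu$ belongs to $\mathcal{W}^{1,p}(\Omega)'$ if $\sup\{\int v\,d\mu : v\in \mathcal{W}^{1,p}(\Omega)\cap C_c(\overline\Omega),\ \|v\|\le1\}<\infty$,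 and then $v\mapsto\int v\,d\mu$ has a unique extension to a continuous linear functional on $\mathcal{W}^{1,p}(\Omega)$, again denoted by $\mu$. Its energy is $E_p(\mu,\Omega)=\|\mu\|_{\mathcal{W}^{1,p}(\Omega)'}^{p'}$. A $\mathrm{Cap}_{p,\Omega}$-measure for $A$ is a Radon measure on $\overline\Omega$ that belongs to $\mathcal{W}^{1,p}(\Omega)'$ and has a potential which is a capacitary extremal for $A$. Theorem. Let $A\subset\overline\Omega$ satisfy $\mathrm{Cap}_{p,\Omega}(A)<\infty$. Then there exists a unique $\mathrm{Cap}_{p,\Omega}$-measure $\mu$ for $A$. Moreover, if $u\in\mathcal{W}^{1,p}(\Omega)$ is a capacitary extremal for $A$, then $$\mathrm{Cap}_{p,\Omega}(A)=\|u\|^p=\mu(u)=E_p(\mu,\Omega).$$ -/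

import Mathlib

open MeasureTheory Filter Topology
open scoped ENNReal ContDiff

noncomputable section

namespace RelCap

/-- `g` is the weak `i`-th partial derivative of `u` on `Ω`: integration by parts holds against
every test function, i.e. every smooth function with compact support contained in `Ω`. -/
def IsWeakPartial {N : ℕ} (Ω : Set (EuclideanSpace ℝ (Fin N))) (i : Fin N)
    (u g : EuclideanSpace ℝ (Fin N) → ℝ) : Prop :=
  ∀ φ : EuclideanSpace ℝ (Fin N) → ℝ, ContDiff ℝ ∞ φ → HasCompactSupport φ → tsupport φ ⊆ Ω →
    ∫ x in Ω, u x * fderiv ℝ φ x (EuclideanSpace.single i 1) = - ∫ x in Ω, g x * φ x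

theorem integrable_Lp_mul {N : ℕ} {p : ℝ≥0∞} [Fact (1 ≤ p)]
    {μ : Measure (EuclideanSpace ℝ (Fin N))} [IsFiniteMeasureOnCompacts μ] (u : Lp ℝ p μ)
    {ψ : EuclideanSpace ℝ (Fin N) → ℝ}
    (hψ : Continuous ψ) (hc : HasCompactSupport ψ) :
    Integrable (fun x => u x * ψ x) μ := by
  have h := ((Lp.memLp u).locallyIntegrable Fact.out).integrable_smul_left_of_hasCompactSupport
    hψ hc
  simpa [mul_comm] using h

theorem continuous_partial {N : ℕ} {φ : EuclideanSpace ℝ (Fin N) → ℝ} (hφ : ContDiff ℝ ∞ φ)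
    (v : EuclideanSpace ℝ (Fin N)) : Continuous (fun x => fderiv ℝ φ x v) :=
  (hφ.continuous_fderiv (by simp)).clm_apply continuous_const

/-- The Sobolev space `W^{1,p}(Ω)`. A function `u ∈ L^p(Ω)` with weak derivatives in `L^p(Ω)` is
recorded together with its (unique) weak partial derivatives: `w none` is the function and
`w (some i)` its `i`-th weak partial derivative. The norm of the `ℓ^p`-product `PiLp p` is
`‖w‖ ^ p = ‖u‖_p ^ p + ∑ i, ‖∂ᵢ u‖_p ^ p`. -/
def Sobolev {N : ℕ} (p : ℝ≥0∞) [Fact (1 ≤ p)] (Ω : Set (EuclideanSpace ℝ (Fin N))) :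
    Submodule ℝ (PiLp p fun _ : Option (Fin N) => Lp ℝ p (volume.restrict Ω)) where
  carrier := {w | ∀ i : Fin N, IsWeakPartial Ω i (w none) (w (some i))}
  zero_mem' := by
    intro i φ _ _ _
    have h0 : ∀ ψ : EuclideanSpace ℝ (Fin N) → ℝ,
        ∫ x in Ω, ((0 : Lp ℝ p (volume.restrict Ω)) x) * ψ x = 0 := by
      intro ψ
      rw [← integral_zero (EuclideanSpace ℝ (Fin N)) ℝ (μ := volume.restrict Ω)]
      apply integral_congr_ae
      filter_upwards [Lp.coeFn_zero ℝ p (volume.restrict Ω)] with x hx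
      rw [hx, Pi.zero_apply, zero_mul]
    exact (h0 _).trans ((neg_eq_zero.2 (h0 _)).symm)
  add_mem' := by
    intro a b ha hb i φ h1 h2 h3
    have key : ∀ (j : Option (Fin N)) (ψ : EuclideanSpace ℝ (Fin N) → ℝ), Continuous ψ →
        HasCompactSupport ψ → ∫ x in Ω, ((a + b) j) x * ψ x
          = (∫ x in Ω, (a j) x * ψ x) + ∫ x in Ω, (b j) x * ψ x := by
      intro j ψ hψ hc
      rw [← integral_add (integrable_Lp_mul (a j) hψ hc) (integrable_Lp_mul (b j) hψ hc)]
      apply integral_congr_ae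
      filter_upwards [Lp.coeFn_add (a j) (b j)] with x hx
      rw [PiLp.add_apply, hx, Pi.add_apply, add_mul]
    rw [key none _ (continuous_partial h1 _) (h2.fderiv_apply ℝ _), key (some i) φ h1.continuous h2,
      ha i φ h1 h2 h3, hb i φ h1 h2 h3]
    ring
  smul_mem' := by
    intro c a ha i φ h1 h2 h3
    have key : ∀ (j : Option (Fin N)) (ψ : EuclideanSpace ℝ (Fin N) → ℝ),
        ∫ x in Ω, ((c • a) j) x * ψ x = c * ∫ x in Ω, (a j) x * ψ x := by
      intro j ψ
      rw [← integral_const_mul]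
      apply integral_congr_ae
      filter_upwards [Lp.coeFn_smul c (a j)] with x hx
      rw [PiLp.smul_apply, hx, Pi.smul_apply, smul_eq_mul, mul_assoc]
    rw [key, key, ha i φ h1 h2 h3]
    ring

/-- A function on `closure Ω` agrees almost everywhere on `Ω` with a Sobolev function. -/
def AgreesOn {N : ℕ} {p : ℝ≥0∞} [Fact (1 ≤ p)] {Ω : Set (EuclideanSpace ℝ (Fin N))}
    (f : closure Ω → ℝ) (w : Sobolev p Ω) : Prop :=
  ∀ᵐ x ∂(volume.restrict Ω), ∀ hx : x ∈ closure Ω, f ⟨x, hx⟩ = w.1 none x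

theorem AgreesOn.add {N : ℕ} {p : ℝ≥0∞} [Fact (1 ≤ p)] {Ω : Set (EuclideanSpace ℝ (Fin N))}
    {f g : closure Ω → ℝ} {v w : Sobolev p Ω} (hf : AgreesOn f v) (hg : AgreesOn g w) :
    AgreesOn (f + g) (v + w) := by
  filter_upwards [hf, hg, Lp.coeFn_add (v.1 none) (w.1 none)] with x h1 h2 h3 hx
  have : (v + w).1 none = v.1 none + w.1 none := rfl
  rw [this, h3, Pi.add_apply, Pi.add_apply, h1 hx, h2 hx]

theorem AgreesOn.smul {N : ℕ} {p : ℝ≥0∞} [Fact (1 ≤ p)] {Ω : Set (EuclideanSpace ℝ (Fin N))}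
    (c : ℝ) {f : closure Ω → ℝ} {v : Sobolev p Ω} (hf : AgreesOn f v) :
    AgreesOn (c • f) (c • v) := by
  filter_upwards [hf, Lp.coeFn_smul c (v.1 none)] with x h1 h3 hx
  have : (c • v).1 none = c • v.1 none := rfl
  rw [this, h3, Pi.smul_apply, Pi.smul_apply, h1 hx]

theorem agreesOn_zero {N : ℕ} {p : ℝ≥0∞} [Fact (1 ≤ p)] {Ω : Set (EuclideanSpace ℝ (Fin N))} :
    AgreesOn (0 : closure Ω → ℝ) (0 : Sobolev p Ω) := by
  filter_upwards [Lp.coeFn_zero ℝ p (volume.restrict Ω)] with x h3 hx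
  have : (0 : Sobolev p Ω).1 none = 0 := rfl
  rw [this, h3]
  rfl

/-- The function in `W^{1,p}(Ω)` determines its weak derivatives, so that a function on
`closure Ω` agrees almost everywhere on `Ω` with at most one element of `W^{1,p}(Ω)`. -/
theorem AgreesOn.unique {N : ℕ} {p : ℝ≥0∞} [Fact (1 ≤ p)]
    {Ω : Set (EuclideanSpace ℝ (Fin N))} (hΩ : IsOpen Ω) {f : closure Ω → ℝ} {v w : Sobolev p Ω}
    (hv : AgreesOn f v) (hw : AgreesOn f w) : v = w := by
  have h0 : v.1 none = w.1 none := by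
    apply Lp.ext
    filter_upwards [hv, hw, ae_restrict_mem hΩ.measurableSet] with x h1 h2 hx
    rw [← h1 (subset_closure hx), h2 (subset_closure hx)]
  apply Subtype.ext
  apply PiLp.ext
  rintro (_ | i)
  · exact h0
  · apply Lp.ext
    have hloc : ∀ g : Lp ℝ p (volume.restrict Ω), LocallyIntegrableOn g Ω volume := fun g =>
      locallyIntegrableOn_of_locallyIntegrable_restrict ((Lp.memLp g).locallyIntegrable Fact.out)
    have hd := hΩ.ae_eq_zero_of_integral_contDiff_smul_eq_zero (μ := volume)
      ((hloc (v.1 (some i))).sub (hloc (w.1 (some i)))) (by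
        intro φ h1 h2 h3
        have e1 := v.2 i φ h1 h2 h3
        have e2 := w.2 i φ h1 h2 h3
        rw [h0, e2, neg_inj] at e1
        have e3 := integral_sub (integrable_Lp_mul (v.1 (some i)) h1.continuous h2)
          (integrable_Lp_mul (w.1 (some i)) h1.continuous h2)
        rw [← e1, sub_self] at e3
        rw [← setIntegral_eq_integral_of_forall_compl_eq_zero (s := Ω), ← e3]
        · apply integral_congr_ae
          refine Eventually.of_forall fun x => ?_
          simp only [smul_eq_mul, Pi.sub_apply]
          ring
        · intro x hx
          rw [image_eq_zero_of_notMem_tsupport (fun h => hx (h3 h)), zero_smul])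
    rw [Filter.EventuallyEq, ae_restrict_iff' hΩ.measurableSet]
    filter_upwards [hd] with x hx hxΩ
    have := hx hxΩ
    rwa [Pi.sub_apply, sub_eq_zero] at this

/-- `W^{1,p}(Ω) ∩ C_c(closure Ω)`: the Sobolev functions that are restrictions to `Ω` of
continuous functions with compact support on `closure Ω`. -/
def ccSobolev {N : ℕ} (p : ℝ≥0∞) [Fact (1 ≤ p)] (Ω : Set (EuclideanSpace ℝ (Fin N))) :
    Submodule ℝ (Sobolev p Ω) where
  carrier := {w | ∃ v : CompactlySupportedContinuousMap (closure Ω) ℝ, AgreesOn v w}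
  zero_mem' := ⟨0, agreesOn_zero⟩
  add_mem' := by
    rintro a b ⟨v, hv⟩ ⟨w, hw⟩
    exact ⟨v + w, hv.add hw⟩
  smul_mem' := by
    rintro c a ⟨v, hv⟩
    exact ⟨c • v, hv.smul c⟩

/-- `W̃^{1,p}(Ω)`: the closure of `W^{1,p}(Ω) ∩ C_c(closure Ω)` in `W^{1,p}(Ω)`. -/
def TildeSobolev {N : ℕ} (p : ℝ≥0∞) [Fact (1 ≤ p)] (Ω : Set (EuclideanSpace ℝ (Fin N))) :
    Submodule ℝ (Sobolev p Ω) :=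
  (ccSobolev p Ω).topologicalClosure

/-- `𝒴_{p,Ω}(A)`: the functions in `W̃^{1,p}(Ω)` that are at least `1` almost everywhere on
`O ∩ Ω` for some relatively open `O ⊆ closure Ω` containing `A`. -/
def admissible {N : ℕ} (p : ℝ≥0∞) [Fact (1 ≤ p)] (Ω : Set (EuclideanSpace ℝ (Fin N)))
    (A : Set (closure Ω)) : Set (TildeSobolev p Ω) :=
  {u | ∃ O : Set (closure Ω), IsOpen O ∧ A ⊆ O ∧
    ∀ᵐ x ∂(volume.restrict Ω), x ∈ (Subtype.val '' O) → 1 ≤ u.1.1 none x}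

/-- The relative `p`-capacity of `A ⊆ closure Ω` (the infimum over the empty set is `∞`). -/
def relCap {N : ℕ} (p : ℝ≥0∞) [Fact (1 ≤ p)] (Ω : Set (EuclideanSpace ℝ (Fin N)))
    (A : Set (closure Ω)) : ℝ≥0∞ :=
  ⨅ u ∈ admissible p Ω A, ENNReal.ofReal (‖u‖ ^ p.toReal)

/-- `f` is quasi continuous on `closure Ω` with respect to the relative capacity. -/
def QuasiContinuous {N : ℕ} (p : ℝ≥0∞) [Fact (1 ≤ p)] (Ω : Set (EuclideanSpace ℝ (Fin N)))
    (f : closure Ω → ℝ) : Prop :=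
  ∀ ε : ℝ≥0∞, 0 < ε → ∃ V : Set (closure Ω), IsOpen V ∧ relCap p Ω V < ε ∧ ContinuousOn f Vᶜ

/-- The equivalence class `[f]`: all quasi continuous functions on `closure Ω` that coincide
with `f` outside a set of relative capacity zero. -/
def quasiClass {N : ℕ} (p : ℝ≥0∞) [Fact (1 ≤ p)] (Ω : Set (EuclideanSpace ℝ (Fin N)))
    (f : closure Ω → ℝ) : Set (closure Ω → ℝ) :=
  {g | QuasiContinuous p Ω g ∧ ∃ P : Set (closure Ω), relCap p Ω P = 0 ∧ ∀ x ∉ P, g x = f x}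

/-- The refined Sobolev space `𝒲^{1,p}(Ω)`: the set of the classes `[f]`, where `f` is a quasi
continuous version of some `u ∈ W̃^{1,p}(Ω)`. -/
def Refined {N : ℕ} (p : ℝ≥0∞) [Fact (1 ≤ p)] (Ω : Set (EuclideanSpace ℝ (Fin N))) : Type :=
  {c : Set (closure Ω → ℝ) // ∃ u : TildeSobolev p Ω, ∃ f : closure Ω → ℝ,
    QuasiContinuous p Ω f ∧ AgreesOn f u.1 ∧ c = quasiClass p Ω f}

/-- The element of `W̃^{1,p}(Ω)` underlying an element of `𝒲^{1,p}(Ω)`; by `Refined.agreesOn`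
below it is the restriction to `Ω` of every representative. The vector space structure and the
norm of `𝒲^{1,p}(Ω)` are those of `W̃^{1,p}(Ω)` under this identification. -/
def Refined.toTilde {N : ℕ} {p : ℝ≥0∞} [Fact (1 ≤ p)] {Ω : Set (EuclideanSpace ℝ (Fin N))}
    (c : Refined p Ω) : TildeSobolev p Ω :=
  c.2.choose

/-- The norm of `𝒲^{1,p}(Ω)`. -/
instance {N : ℕ} {p : ℝ≥0∞} [Fact (1 ≤ p)] {Ω : Set (EuclideanSpace ℝ (Fin N))} :
    Norm (Refined p Ω) :=
  ⟨fun c => ‖c.toTilde‖⟩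

theorem relCap_empty {N : ℕ} {p : ℝ≥0∞} [Fact (1 ≤ p)] (hp : p < ⊤)
    {Ω : Set (EuclideanSpace ℝ (Fin N))} : relCap p Ω ∅ = 0 := by
  have hp0 : p.toReal ≠ 0 := (ENNReal.toReal_pos
    (zero_lt_one.trans_le (Fact.out : (1 : ℝ≥0∞) ≤ p)).ne' hp.ne).ne'
  refine le_antisymm (iInf₂_le_of_le 0 ⟨∅, isOpen_empty, subset_rfl, by simp⟩ ?_) bot_le
  simp [Real.zero_rpow hp0]

/-- Sets of relative capacity zero are Lebesgue null in `Ω`. -/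
theorem ae_notMem_of_relCap_eq_zero {N : ℕ} {p : ℝ≥0∞} [Fact (1 ≤ p)] (hp : p < ⊤)
    {Ω : Set (EuclideanSpace ℝ (Fin N))} {P : Set (closure Ω)} (hP : relCap p Ω P = 0) :
    ∀ᵐ x ∂(volume.restrict Ω), x ∉ (Subtype.val '' P) := by
  have hp0 : p ≠ 0 := (zero_lt_one.trans_le (Fact.out : (1 : ℝ≥0∞) ≤ p)).ne'
  have hpr : 0 < p.toReal := ENNReal.toReal_pos hp0 hp.ne
  suffices h : volume.restrict Ω (Subtype.val '' P) ≤ relCap p Ω P by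
    rw [hP] at h
    have h' := le_antisymm h bot_le
    rw [ae_iff]
    simpa only [not_not, Set.ofPred_mem_eq] using h'
  refine le_iInf₂ fun u ⟨O, _, hPO, hu⟩ => ?_
  have h1 : volume.restrict Ω (Subtype.val '' P)
      ≤ volume.restrict Ω {x | (1 : ℝ≥0∞) ≤ ‖u.1.1 none x‖ₑ} := by
    apply measure_mono_ae
    filter_upwards [hu] with x hx hxP
    have h2 : 1 ≤ u.1.1 none x := hx (Set.image_mono hPO hxP)
    change (1 : ℝ≥0∞) ≤ ‖u.1.1 none x‖ₑ
    rw [Real.enorm_eq_ofReal (zero_le_one.trans h2)]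
    simpa using h2
  have h3 := mul_meas_ge_le_pow_eLpNorm' (volume.restrict Ω) hp0 hp.ne
    (Lp.aestronglyMeasurable (u.1.1 none)) 1
  rw [ENNReal.one_rpow, one_mul] at h3
  refine (h1.trans h3).trans ?_
  have h4 : ‖u.1.1 none‖ ≤ ‖u‖ := PiLp.norm_apply_le u.1.1 none
  rw [← ENNReal.ofReal_rpow_of_nonneg (norm_nonneg u) hpr.le]
  gcongr
  rw [← Lp.enorm_def, ← ofReal_norm]
  exact ENNReal.ofReal_le_ofReal h4

theorem Refined.agreesOn {N : ℕ} {p : ℝ≥0∞} [Fact (1 ≤ p)] (hp : p < ⊤)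
    {Ω : Set (EuclideanSpace ℝ (Fin N))} (c : Refined p Ω) {f : closure Ω → ℝ} (hf : f ∈ c.1) :
    AgreesOn f c.toTilde.1 := by
  obtain ⟨g, _, h2, h3⟩ := c.2.choose_spec
  rw [h3] at hf
  obtain ⟨_, P, hP, hPf⟩ := hf
  filter_upwards [h2, ae_notMem_of_relCap_eq_zero hp hP] with x h4 h5 hx
  rw [hPf _ (fun h => h5 ⟨_, h, rfl⟩)]
  exact h4 hx

theorem Refined.nonempty {N : ℕ} {p : ℝ≥0∞} [Fact (1 ≤ p)] (hp : p < ⊤)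
    {Ω : Set (EuclideanSpace ℝ (Fin N))} (c : Refined p Ω) : c.1.Nonempty := by
  obtain ⟨u, f, h1, _, h3⟩ := c.2
  rw [h3]
  exact ⟨f, h1, ∅, relCap_empty hp, fun _ _ => rfl⟩

/-- The topological dual `𝒲^{1,p}(Ω)'`, with the operator norm. A functional acts on
`𝒲^{1,p}(Ω)` through the isometric identification with `W̃^{1,p}(Ω)`. -/
abbrev RefinedDual {N : ℕ} (p : ℝ≥0∞) [Fact (1 ≤ p)] (Ω : Set (EuclideanSpace ℝ (Fin N))) :
    Type :=
  StrongDual ℝ (TildeSobolev p Ω)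

/-- `c` is a potential of the functional `Φ`: it minimizes `‖v‖ ^ p / p - Φ v` on
`𝒲^{1,p}(Ω)`. -/
def IsPotential {N : ℕ} (p : ℝ≥0∞) [Fact (1 ≤ p)] (Ω : Set (EuclideanSpace ℝ (Fin N)))
    (Φ : RefinedDual p Ω) (c : Refined p Ω) : Prop :=
  ∀ v : Refined p Ω, 1 / p.toReal * ‖c‖ ^ p.toReal - Φ c.toTilde
    ≤ 1 / p.toReal * ‖v‖ ^ p.toReal - Φ v.toTilde

/-- `c` is a capacitary extremal for `A`: its representatives are at least `1` quasi everywhere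
on `A`, and `‖c‖ ^ p` is the relative capacity of `A`. -/
def IsExtremal {N : ℕ} (p : ℝ≥0∞) [Fact (1 ≤ p)] (Ω : Set (EuclideanSpace ℝ (Fin N)))
    (A : Set (closure Ω)) (c : Refined p Ω) : Prop :=
  (∀ f ∈ c.1, ∃ P : Set (closure Ω), relCap p Ω P = 0 ∧ ∀ x ∈ A, x ∉ P → 1 ≤ f x) ∧
    ENNReal.ofReal (‖c‖ ^ p.toReal) = relCap p Ω A

/-- Radon measures: inner regular (with respect to compact sets) and locally finite. -/
def IsRadon {X : Type*} [TopologicalSpace X] [MeasurableSpace X] (μ : Measure X) : Prop :=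
  μ.InnerRegular ∧ IsLocallyFiniteMeasure μ

/-- A measure on `closure Ω` belongs to `𝒲^{1,p}(Ω)'`: the integrals of the functions in
`𝒲^{1,p}(Ω) ∩ C_c(closure Ω)` of norm at most `1` are bounded above. -/
def BelongsToDual {N : ℕ} (p : ℝ≥0∞) [Fact (1 ≤ p)] (Ω : Set (EuclideanSpace ℝ (Fin N)))
    (μ : Measure (closure Ω)) : Prop :=
  BddAbove {r : ℝ | ∃ (v : CompactlySupportedContinuousMap (closure Ω) ℝ) (w : Sobolev p Ω),
    AgreesOn v w ∧ ‖w‖ ≤ 1 ∧ r = ∫ x, v x ∂μ}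

/-- `Φ` extends `v ↦ ∫ v dμ` from `𝒲^{1,p}(Ω) ∩ C_c(closure Ω)`. -/
def IsExtension {N : ℕ} {p : ℝ≥0∞} [Fact (1 ≤ p)] {Ω : Set (EuclideanSpace ℝ (Fin N))}
    (μ : Measure (closure Ω)) (Φ : RefinedDual p Ω) : Prop :=
  ∀ (v : CompactlySupportedContinuousMap (closure Ω) ℝ) (w : TildeSobolev p Ω),
    AgreesOn v w.1 → Φ w = ∫ x, v x ∂μ

theorem AgreesOn.eq_of_continuous {N : ℕ} {p : ℝ≥0∞} [Fact (1 ≤ p)]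
    {Ω : Set (EuclideanSpace ℝ (Fin N))} (hΩ : IsOpen Ω) {f g : closure Ω → ℝ} {w : Sobolev p Ω}
    (hfc : Continuous f) (hgc : Continuous g) (hf : AgreesOn f w) (hg : AgreesOn g w) :
    f = g := by
  classical
  have hd : DenseRange (Set.inclusion (subset_closure (s := Ω))) :=
    (denseRange_inclusion_iff _).2 subset_rfl
  have hι : Continuous (Set.inclusion (subset_closure (s := Ω))) := continuous_inclusion _
  refine hd.equalizer hfc hgc (funext fun y => ?_)
  let ext (h : closure Ω → ℝ) (x : EuclideanSpace ℝ (Fin N)) : ℝ :=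
    if hx : x ∈ closure Ω then h ⟨x, hx⟩ else 0
  have hext : ∀ h : closure Ω → ℝ,
      Ω.domRestrict (ext h) = h ∘ Set.inclusion (subset_closure (s := Ω)) := by
    intro h
    funext z
    exact dif_pos (subset_closure z.2)
  have hcont : ∀ h : closure Ω → ℝ, Continuous h → ContinuousOn (ext h) Ω := by
    intro h hh
    rw [continuousOn_iff_continuous_domRestrict, hext]
    exact hh.comp hι
  have hae : ext f =ᵐ[volume.restrict Ω] ext g := by
    filter_upwards [hf, hg, ae_restrict_mem hΩ.measurableSet] with x h1 h2 hx
    have hx' := subset_closure hx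
    simp only [ext, dif_pos hx', h1 hx', h2 hx']
  have := Measure.eqOn_open_of_ae_eq hae hΩ (hcont f hfc) (hcont g hgc) y.2
  rw [← hext f, ← hext g]
  exact this

theorem existsUnique_extension_closure {X : Type*} [NormedAddCommGroup X] [NormedSpace ℝ X]
    (S : Submodule ℝ X) (L : S →ₗ[ℝ] ℝ) (M : ℝ) (hL1 : ∀ w : S, ‖w‖ ≤ 1 → L w ≤ M) :
    ∃! Φ : StrongDual ℝ S.topologicalClosure,
      ∀ w : S, Φ ⟨w.1, S.le_topologicalClosure w.2⟩ = L w := by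
  have hL2 : ∀ w : S, L w ≤ M * ‖w‖ := by
    intro w
    rcases eq_or_ne w 0 with rfl | hw
    · simp
    · have hpos : 0 < ‖w‖ := norm_pos_iff.2 hw
      have h := hL1 (‖w‖⁻¹ • w) (by rw [norm_smul, norm_inv, norm_norm, inv_mul_cancel₀ hpos.ne'])
      rw [map_smul, smul_eq_mul, inv_mul_le_iff₀ hpos] at h
      linarith
  have hL3 : ∀ w : S, ‖L w‖ ≤ M * ‖w‖ := by
    intro w
    rw [Real.norm_eq_abs, abs_le]
    have h := hL2 (-w)
    rw [map_neg, norm_neg] at h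
    exact ⟨by linarith, hL2 w⟩
  let e : S →ₗᵢ[ℝ] S.topologicalClosure :=
    { Submodule.inclusion S.le_topologicalClosure with norm_map' := fun _ => rfl }
  have he : DenseRange e :=
    (denseRange_inclusion_iff (s := (S : Set X)) S.le_topologicalClosure).2 subset_rfl
  have h := ContinuousLinearMap.extend_eq (L.mkContinuous M hL3) (e := e.toContinuousLinearMap) he
      e.isometry.isUniformInducing
  refine ⟨(L.mkContinuous M hL3).extend e.toContinuousLinearMap, h, ?_⟩
  intro Φ hΦ
  refine ContinuousLinearMap.ext fun w => ?_
  refine congrFun (he.equalizer Φ.continuous (ContinuousLinearMap.continuous _)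
    (funext fun z => ?_)) w
  exact (hΦ z).trans (h z).symm

/-- A Radon measure that belongs to `𝒲^{1,p}(Ω)'` has a unique continuous extension. -/
theorem existsUnique_isExtension {N : ℕ} {p : ℝ≥0∞} [Fact (1 ≤ p)]
    {Ω : Set (EuclideanSpace ℝ (Fin N))} (hΩ : IsOpen Ω) {μ : Measure (closure Ω)}
    (hμ : IsRadon μ) (hd : BelongsToDual p Ω μ) :
    ∃! Φ : RefinedDual p Ω, IsExtension μ Φ := by
  have := hμ.2
  have hint : ∀ v : CompactlySupportedContinuousMap (closure Ω) ℝ, Integrable v μ := fun v =>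
    v.continuous.integrable_of_hasCompactSupport v.hasCompactSupport
  choose r hr using fun w : ccSobolev p Ω => w.2
  have hr' : ∀ (w : ccSobolev p Ω) (v : CompactlySupportedContinuousMap (closure Ω) ℝ),
      AgreesOn v w.1 → (r w : closure Ω → ℝ) = v := fun w v hv =>
    (hr w).eq_of_continuous hΩ (r w).continuous v.continuous hv
  let L : ccSobolev p Ω →ₗ[ℝ] ℝ :=
    { toFun := fun w => ∫ x, r w x ∂μ
      map_add' := by
        intro a b
        have h := hr' (a + b) (r a + r b) ((hr a).add (hr b))
        rw [h, ← integral_add (hint _) (hint _)]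
        rfl
      map_smul' := by
        intro c a
        have h := hr' (c • a) (c • r a) ((hr a).smul c)
        rw [h, RingHom.id_apply, smul_eq_mul, ← integral_const_mul]
        rfl }
  obtain ⟨M, hM⟩ := hd
  obtain ⟨Φ, hΦ, hΦu⟩ := existsUnique_extension_closure (ccSobolev p Ω) L M fun w hw =>
    hM ⟨r w, w.1, hr w, hw, rfl⟩
  refine ⟨Φ, fun v w hv => ?_, fun Ψ hΨ => hΦu Ψ fun w => hΨ (r w) ⟨w.1, _⟩ (hr w)⟩
  refine (hΦ ⟨w.1, v, hv⟩).trans ?_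
  change ∫ x, r ⟨w.1, v, hv⟩ x ∂μ = _
  rw [hr' ⟨w.1, v, hv⟩ v hv]

open Classical in
/-- The continuous functional on `𝒲^{1,p}(Ω)` given by a Radon measure `μ` that belongs to
`𝒲^{1,p}(Ω)'`: the unique continuous extension of `v ↦ ∫ v dμ` (see `existsUnique_isExtension`);
it is `0` by convention if there is no continuous extension. -/
def toDual {N : ℕ} (p : ℝ≥0∞) [Fact (1 ≤ p)] (Ω : Set (EuclideanSpace ℝ (Fin N)))
    (μ : Measure (closure Ω)) : RefinedDual p Ω :=
  if h : ∃ Φ : RefinedDual p Ω, IsExtension μ Φ then h.choose else 0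

/-- The energy `E_p(μ, Ω) = ‖μ‖ ^ p'` with `1 / p + 1 / p' = 1`, where `‖μ‖` is the norm in
`𝒲^{1,p}(Ω)'`. -/
def energy {N : ℕ} (p : ℝ≥0∞) [Fact (1 ≤ p)] (Ω : Set (EuclideanSpace ℝ (Fin N)))
    (μ : Measure (closure Ω)) : ℝ :=
  ‖toDual p Ω μ‖ ^ (Real.conjExponent p.toReal)

/-- `μ` is a capacitary measure for `A`: a Radon measure on `closure Ω` belonging to
`𝒲^{1,p}(Ω)'` whose potential is the capacitary extremal for `A`. -/
def IsCapMeasure {N : ℕ} (p : ℝ≥0∞) [Fact (1 ≤ p)] (Ω : Set (EuclideanSpace ℝ (Fin N)))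
    (A : Set (closure Ω)) (μ : Measure (closure Ω)) : Prop :=
  IsRadon μ ∧ BelongsToDual p Ω μ ∧
    ∃ u : Refined p Ω, IsPotential p Ω (toDual p Ω μ) u ∧ IsExtremal p Ω A u

end RelCap

end

/-!
By uniform convexity `W̃^{1,p}(Ω)` contains a unique element of least norm among those having a
quasi continuous representative that is `≥ 1` q.e. on `A`; it is the capacitary extremal `u`. The
norm is Gâteaux differentiable, and the derivative `Φ` of `‖·‖ ^ p / p` at `u` is the only
functional having `u` as a potential. As `u + v` remains admissible for `v ≥ 0`, `Φ` is positive, so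
on the dense space of Sobolev functions in `C_c(closure Ω)` the Riesz representation theorem turns
it into a Radon measure, which is determined by `Φ`. The identities are the equality case of Young's
inequality `Φ u ≤ ‖u‖ ^ p / p + ‖Φ‖ ^ p' / p'`.
-/

namespace RelCap

open CompactlySupported

section UniformlyConvex

theorem exists_mem_norm_lt_infDist_add {E : Type*} [SeminormedAddCommGroup E] {K : Set E}
    (hne : K.Nonempty) (n : ℕ) :
    ∃ w ∈ K, ‖w‖ < Metric.infDist 0 K + 1 / ((n : ℝ) + 1) := by
  simpa only [dist_zero_left] using (Metric.infDist_lt_iff hne).1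
    (lt_add_of_pos_right (Metric.infDist 0 K) Nat.one_div_pos_of_nat)

theorem eq_of_isMinOn_norm_of_convex {E : Type*} [NormedAddCommGroup E] [NormedSpace ℝ E]
    [StrictConvexSpace ℝ E] {K : Set E} (hK : Convex ℝ K) {x y : E} (hx : x ∈ K) (hy : y ∈ K)
    (hxmin : IsMinOn norm K x) (hymin : IsMinOn norm K y) : x = y := by
  by_contra hne
  have hlt := norm_combo_lt_of_ne (hxmin hy) le_rfl hne (by norm_num : (0 : ℝ) < 1 / 2)
    (by norm_num : (0 : ℝ) < 1 / 2) (by norm_num)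
  exact hlt.not_ge (hymin (hK hx hy (by norm_num) (by norm_num) (by norm_num)))

variable {E F : Type*} [NormedAddCommGroup E] [NormedSpace ℝ E] [NormedAddCommGroup F]
  [NormedSpace ℝ F]

theorem uniformConvexSpace_of_linearIsometry [UniformConvexSpace F] (T : E →ₗᵢ[ℝ] F) :
    UniformConvexSpace E := by
  refine ⟨fun ε hε => ?_⟩
  obtain ⟨δ, hδ, h⟩ := exists_forall_sphere_dist_add_le_two_sub F hε
  refine ⟨δ, hδ, fun x hx y hy hxy => ?_⟩
  rw [← T.norm_map, map_add]
  exact h (by rwa [T.norm_map]) (by rwa [T.norm_map]) (by rwa [← map_sub, T.norm_map])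

variable [UniformConvexSpace E]

theorem cauchy_map_of_tendsto_norm_add {ι : Type*} {l : Filter ι} [NeBot l] {u : ι → E} {d : ℝ}
    (hu : Tendsto (fun i => ‖u i‖) l (𝓝 d))
    (huu : Tendsto (fun z : ι × ι => ‖u z.1 + u z.2‖) (l ×ˢ l) (𝓝 (2 * d))) :
    Cauchy (map u l) := by
  have hu₁ : Tendsto (fun z : ι × ι => ‖u z.1‖) (l ×ˢ l) (𝓝 d) := hu.comp tendsto_fst
  have hu₂ : Tendsto (fun z : ι × ι => ‖u z.2‖) (l ×ˢ l) (𝓝 d) := hu.comp tendsto_snd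
  suffices h : Tendsto (fun z : ι × ι => ‖u z.1 - u z.2‖) (l ×ˢ l) (𝓝 0) by
    refine cauchy_map_iff.2 ⟨‹_›, ?_⟩
    rw [Metric.uniformity_eq_comap_nhds_zero, tendsto_comap_iff]
    simpa only [Function.comp_def, dist_eq_norm] using h
  have hd : 0 ≤ d := ge_of_tendsto' hu fun _ => norm_nonneg _
  rcases hd.eq_or_lt with rfl | hd
  · exact squeeze_zero (fun _ => norm_nonneg _) (fun z => norm_sub_le (u z.1) (u z.2))
      (by simpa using hu₁.add hu₂)
  rw [Metric.tendsto_nhds]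
  intro ε hε
  obtain ⟨δ, hδ, hball⟩ := exists_forall_closed_ball_dist_add_le_two_sub E
    (div_pos hε (by linarith : 0 < d + 1))
  obtain ⟨r, ⟨hδr, hr1⟩, hdr⟩ : ∃ r, ((2 - δ) * r < 2 * d ∧ r < d + 1) ∧ d < r := by
    have hlim : Tendsto (fun r : ℝ => (2 - δ) * r) (𝓝 d) (𝓝 ((2 - δ) * d)) :=
      (continuous_const_mul _).tendsto d
    have hev := (hlim.eventually (gt_mem_nhds (by nlinarith : (2 - δ) * d < 2 * d))).and
      (gt_mem_nhds (lt_add_one d))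
    exact ((hev.filter_mono nhdsWithin_le_nhds).and (self_mem_nhdsWithin (s := Set.Ioi d))).exists
  have hr : 0 < r := hd.trans hdr
  filter_upwards [hu₁.eventually (gt_mem_nhds hdr), hu₂.eventually (gt_mem_nhds hdr),
    huu.eventually (lt_mem_nhds hδr)] with z h₁ h₂ hsum
  rw [dist_zero_right, norm_norm]
  by_contra! hge
  have hscale : ∀ x : E, ‖r⁻¹ • x‖ = ‖x‖ / r := fun x => by
    rw [norm_smul_of_nonneg (inv_nonneg.2 hr.le), div_eq_inv_mul]
  have hle := hball (x := r⁻¹ • u z.1) ((hscale _).trans_le ((div_le_one hr).2 h₁.le))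
    (y := r⁻¹ • u z.2) ((hscale _).trans_le ((div_le_one hr).2 h₂.le))
    (by rw [← smul_sub, hscale]; gcongr)
  rw [← smul_add, hscale, div_le_iff₀ hr] at hle
  exact hsum.not_ge hle

variable [CompleteSpace E]

theorem nonempty_iInter_of_convex_of_isClosed {K : ℕ → Set E} (hanti : Antitone K)
    (hconv : ∀ n, Convex ℝ (K n)) (hclosed : ∀ n, IsClosed (K n)) {R : ℝ}
    (hR : ∀ n, ∃ w ∈ K n, ‖w‖ ≤ R) : (⋂ n, K n).Nonempty := by
  have hne : ∀ n, (K n).Nonempty := fun n => (hR n).imp fun _ hw => hw.1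
  let d : ℕ → ℝ := fun n => Metric.infDist 0 (K n)
  have hd_le : ∀ n, ∀ w ∈ K n, d n ≤ ‖w‖ := fun n w hw =>
    (Metric.infDist_le_dist_of_mem hw).trans_eq (dist_zero_left w)
  have hd_mono : Monotone d := fun m n hmn =>
    Metric.infDist_le_infDist_of_subset (hanti hmn) (hne n)
  have hd_bdd : BddAbove (Set.range d) := ⟨R, by
    rintro _ ⟨n, rfl⟩
    obtain ⟨w, hw, hwR⟩ := hR n
    exact (hd_le n w hw).trans hwR⟩
  have hd_lim := tendsto_atTop_ciSup hd_mono hd_bdd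
  set D : ℝ := ⨆ n, d n
  choose s hsK hs using fun n => exists_mem_norm_lt_infDist_add (hne n) n
  have hs_lim : Tendsto (fun n => ‖s n‖) atTop (𝓝 D) :=
    tendsto_of_tendsto_of_tendsto_of_le_of_le hd_lim
      (by simpa using hd_lim.add (tendsto_one_div_add_atTop_nhds_zero_nat (𝕜 := ℝ)))
      (fun n => hd_le n _ (hsK n)) fun n => (hs n).le
  have hmid : ∀ m n, 2 * d (min m n) ≤ ‖s m + s n‖ := fun m n => by
    have hmem := (hconv (min m n)).midpoint_mem (hanti (min_le_left m n) (hsK m))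
      (hanti (min_le_right m n) (hsK n))
    have h := hd_le _ _ hmem
    rw [midpoint_eq_smul_add, norm_smul_of_nonneg (by norm_num)] at h
    norm_num at h
    linarith
  have hmin : Tendsto (fun z : ℕ × ℕ => min z.1 z.2) (atTop ×ˢ atTop) atTop :=
    tendsto_atTop.2 fun k => ((eventually_ge_atTop k).prod_mk (eventually_ge_atTop k)).mono
      fun _ hz => le_min hz.1 hz.2
  have hsum : Tendsto (fun z : ℕ × ℕ => ‖s z.1 + s z.2‖) (atTop ×ˢ atTop) (𝓝 (2 * D)) := by
    refine tendsto_of_tendsto_of_tendsto_of_le_of_le ((hd_lim.comp hmin).const_mul 2) ?_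
      (fun z => hmid z.1 z.2) fun z => norm_add_le _ _
    simpa only [two_mul, Function.comp_def] using
      (hs_lim.comp tendsto_fst).add (hs_lim.comp tendsto_snd)
  obtain ⟨z, hz⟩ := cauchySeq_tendsto_of_complete (cauchy_map_of_tendsto_norm_add hs_lim hsum)
  exact ⟨z, Set.mem_iInter.2 fun n => (hclosed n).mem_of_tendsto hz
    ((eventually_ge_atTop n).mono fun m hm => hanti hm (hsK m))⟩

theorem exists_isMinOn_norm {K : Set E} (hconv : Convex ℝ K) (hclosed : IsClosed K)
    (hne : K.Nonempty) : ∃ z ∈ K, IsMinOn norm K z := by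
  set d : ℝ := Metric.infDist 0 K
  obtain ⟨z, hz⟩ := nonempty_iInter_of_convex_of_isClosed
    (K := fun n : ℕ => K ∩ Metric.closedBall 0 (d + 1 / ((n : ℝ) + 1)))
    (fun m n hmn => Set.inter_subset_inter_right K (Metric.closedBall_subset_closedBall
      (by have := Nat.one_div_le_one_div (α := ℝ) hmn; linarith)))
    (fun n => hconv.inter (convex_closedBall _ _))
    (fun n => hclosed.inter Metric.isClosed_closedBall) (R := d + 1) fun n => by
      obtain ⟨w, hw, hwd⟩ := exists_mem_norm_lt_infDist_add hne n
      have hn : 1 / ((n : ℝ) + 1) ≤ 1 := by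
        simpa using Nat.one_div_le_one_div (α := ℝ) (Nat.zero_le n)
      exact ⟨w, ⟨hw, by simpa using hwd.le⟩, by linarith⟩
  rw [Set.mem_iInter] at hz
  refine ⟨z, (hz 0).1, fun w hw => ?_⟩
  have hzd : ‖z‖ ≤ d := ge_of_tendsto'
    (by simpa using (tendsto_one_div_add_atTop_nhds_zero_nat (𝕜 := ℝ)).const_add d)
    fun n => by simpa using (hz n).2
  exact hzd.trans ((Metric.infDist_le_dist_of_mem hw).trans_eq (dist_zero_left w))

theorem isClosed_image_closedBall (T : E →L[ℝ] F) (R : ℝ) :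
    IsClosed (T '' Metric.closedBall 0 R) := by
  refine isClosed_of_closure_subset fun y hy => ?_
  obtain ⟨z, hz⟩ := nonempty_iInter_of_convex_of_isClosed
    (K := fun n : ℕ =>
      Metric.closedBall 0 R ∩ T ⁻¹' Metric.closedBall y (1 / ((n : ℝ) + 1)))
    (fun m n hmn => Set.inter_subset_inter_right _ (Set.preimage_mono
      (Metric.closedBall_subset_closedBall (Nat.one_div_le_one_div hmn))))
    (fun n => (convex_closedBall _ _).inter
      ((convex_closedBall y _).linear_preimage T.toLinearMap))
    (fun n => Metric.isClosed_closedBall.inter (Metric.isClosed_closedBall.preimage T.continuous))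
    (R := R) fun n => by
      obtain ⟨_, ⟨w, hw, rfl⟩, hdist⟩ := Metric.mem_closure_iff.1 hy (1 / ((n : ℝ) + 1))
        Nat.one_div_pos_of_nat
      exact ⟨w, ⟨hw, by simpa [dist_comm] using hdist.le⟩, by simpa using hw⟩
  rw [Set.mem_iInter] at hz
  refine ⟨z, (hz 0).1, dist_le_zero.1 (ge_of_tendsto' tendsto_one_div_add_atTop_nhds_zero_nat
    fun n => (hz n).2)⟩

end UniformlyConvex

section NormPower

variable {E : Type*} [NormedAddCommGroup E] [NormedSpace ℝ E] {q : ℝ} {Φ : StrongDual ℝ E} {u : E}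

theorem exists_isMinOn_norm_rpow_sub (hq : 1 < q) (u : E) :
    ∃ Φ : StrongDual ℝ E, IsMinOn (fun v => 1 / q * ‖v‖ ^ q - Φ v) Set.univ u := by
  obtain ⟨g, hg, hgu⟩ := exists_dual_vector'' ℝ u
  have hconj := Real.HolderConjugate.conjExponent hq
  set q' := q.conjExponent
  refine ⟨‖u‖ ^ (q - 1) • g, fun v _ => ?_⟩
  have hself : ‖u‖ ^ (q - 1) * ‖u‖ = ‖u‖ ^ q := by
    rw [← Real.rpow_add_one' (norm_nonneg u) (by linarith), sub_add_cancel]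
  have hpow : (‖u‖ ^ (q - 1)) ^ q' = ‖u‖ ^ q := by
    rw [← Real.rpow_mul (norm_nonneg u), hconj.sub_one_mul_conj]
  have hyoung : ‖u‖ ^ (q - 1) * ‖v‖ ≤ ‖u‖ ^ q / q' + ‖v‖ ^ q / q := by
    simpa only [hpow] using
      Real.young_inequality_of_nonneg
      (Real.rpow_nonneg (norm_nonneg u) (q - 1)) (norm_nonneg v) hconj.symm
  have hgv : ‖u‖ ^ (q - 1) * g v ≤ ‖u‖ ^ (q - 1) * ‖v‖ := by
    gcongr
    exact (le_abs_self _).trans ((g.le_opNorm v).trans (mul_le_of_le_one_left (norm_nonneg v) hg))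
  have hinv : ‖u‖ ^ q / q' = ‖u‖ ^ q - 1 / q * ‖u‖ ^ q := by
    rw [div_eq_mul_inv _ q', ← hconj.one_sub_inv, one_div]
    ring
  have hgu' : ‖u‖ ^ (q - 1) * g u = ‖u‖ ^ q := by rw [hgu]; exact hself
  calc 1 / q * ‖u‖ ^ q - ‖u‖ ^ (q - 1) * g u
      = 1 / q * ‖v‖ ^ q - (‖u‖ ^ q / q' + ‖v‖ ^ q / q) := by rw [hinv, hgu']; ring
    _ ≤ 1 / q * ‖v‖ ^ q - ‖u‖ ^ (q - 1) * g v := by linarith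

theorem lineDeriv_eq_apply_of_isMinOn (hq : q ≠ 0)
    (h : IsMinOn (fun v => 1 / q * ‖v‖ ^ q - Φ v) Set.univ u) {v : E}
    (hv : LineDifferentiableAt ℝ (fun w : E => ‖w‖ ^ q) u v) :
    lineDeriv ℝ (fun w : E => ‖w‖ ^ q) u v = q * Φ v := by
  have hΦ : HasDerivAt (fun t : ℝ => Φ (u + t • v)) (Φ v) 0 := by
    simpa using ((hasDerivAt_id (0 : ℝ)).mul_const (Φ v)).const_add (Φ u)
  have hderiv := (hv.hasLineDerivAt.const_mul (1 / q)).fun_sub hΦ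
  have hmin : IsLocalMin (fun t : ℝ => 1 / q * ‖u + t • v‖ ^ q - Φ (u + t • v)) 0 :=
    Eventually.of_forall fun t => by simpa using h (Set.mem_univ (u + t • v))
  have hzero := hmin.hasDerivAt_eq_zero hderiv
  field_simp at hzero
  linarith

theorem eq_of_isMinOn_norm_rpow_sub (hq : q ≠ 0) {Ψ : StrongDual ℝ E}
    (hu : ∀ v, LineDifferentiableAt ℝ (fun w : E => ‖w‖ ^ q) u v)
    (hΦ : IsMinOn (fun v => 1 / q * ‖v‖ ^ q - Φ v) Set.univ u)
    (hΨ : IsMinOn (fun v => 1 / q * ‖v‖ ^ q - Ψ v) Set.univ u) : Φ = Ψ := by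
  ext v
  refine mul_left_cancel₀ hq ?_
  rw [← lineDeriv_eq_apply_of_isMinOn hq hΦ (hu v), lineDeriv_eq_apply_of_isMinOn hq hΨ (hu v)]

theorem apply_self_of_isMinOn (hq : q ≠ 0)
    (h : IsMinOn (fun v => 1 / q * ‖v‖ ^ q - Φ v) Set.univ u) : Φ u = ‖u‖ ^ q := by
  have hderiv : HasDerivAt (fun t : ℝ => (1 + t) ^ q * ‖u‖ ^ q) (q * ‖u‖ ^ q) 0 := by
    simpa using (((hasDerivAt_id (0 : ℝ)).const_add 1).rpow_const (p := q)
      (Or.inl (by norm_num))).mul_const (‖u‖ ^ q)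
  have hline : HasLineDerivAt ℝ (fun w : E => ‖w‖ ^ q) (q * ‖u‖ ^ q) u u := by
    refine hderiv.congr_of_eventuallyEq ?_
    filter_upwards [lt_mem_nhds (by norm_num : (-1 : ℝ) < 0)] with t ht
    have ht' : 0 ≤ 1 + t := by linarith
    rw [← Real.mul_rpow ht' (norm_nonneg u), ← norm_smul_of_nonneg ht', add_smul, one_smul]
  have := lineDeriv_eq_apply_of_isMinOn hq h hline.lineDifferentiableAt
  rw [hline.lineDeriv] at this
  exact (mul_left_cancel₀ hq this).symm

theorem norm_rpow_conjExponent_div_le (hq : 1 < q) {c : ℝ}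
    (h : ∀ v, Φ v - 1 / q * ‖v‖ ^ q ≤ c) : ‖Φ‖ ^ q.conjExponent / q.conjExponent ≤ c := by
  have hconj := Real.HolderConjugate.conjExponent hq
  set q' := q.conjExponent
  -- Test with the multiples `s • x` of unit vectors for which Young's inequality is an equality.
  set s : ℝ := ‖Φ‖ ^ (q' - 1)
  have hs : 0 ≤ s := by positivity
  have hsq : s ^ q = ‖Φ‖ ^ q' := by
    rw [← Real.rpow_mul (norm_nonneg Φ), hconj.symm.sub_one_mul_conj]
  have hsΦ : s * ‖Φ‖ = ‖Φ‖ ^ q' := by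
    rw [← Real.rpow_add_one' (norm_nonneg Φ) (by linarith [hconj.symm.pos]), sub_add_cancel]
  have hunit : ∀ x : E, ‖x‖ = 1 → s * Φ x ≤ c + 1 / q * ‖Φ‖ ^ q' := fun x hx => by
    have := h (s • x)
    rw [map_smul, smul_eq_mul, norm_smul_of_nonneg hs, hx, mul_one, hsq] at this
    linarith
  have hc : 0 ≤ c := by simpa [Real.zero_rpow hconj.ne_zero] using h 0
  have hle : ‖s • Φ‖ ≤ c + 1 / q * ‖Φ‖ ^ q' := by
    have := hconj.pos
    refine ContinuousLinearMap.opNorm_le_of_unit_norm (by positivity) fun x hx => ?_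
    have hneg := hunit (-x) (by rwa [norm_neg])
    rw [map_neg, mul_neg] at hneg
    rw [smul_apply, smul_eq_mul, Real.norm_eq_abs]
    exact abs_le.2 ⟨by linarith, hunit x hx⟩
  rw [norm_smul, Real.norm_of_nonneg hs, hsΦ] at hle
  calc ‖Φ‖ ^ q' / q' = ‖Φ‖ ^ q' - 1 / q * ‖Φ‖ ^ q' := by
        rw [div_eq_mul_inv _ q', ← hconj.one_sub_inv, one_div]; ring
    _ ≤ c := by linarith

theorem norm_rpow_conjExponent_of_isMinOn (hq : 1 < q)
    (h : IsMinOn (fun v => 1 / q * ‖v‖ ^ q - Φ v) Set.univ u) :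
    ‖Φ‖ ^ q.conjExponent = ‖u‖ ^ q := by
  have hconj := Real.HolderConjugate.conjExponent hq
  have hself := apply_self_of_isMinOn hconj.ne_zero h
  have hinv : ‖u‖ ^ q / q.conjExponent = ‖u‖ ^ q - 1 / q * ‖u‖ ^ q := by
    rw [div_eq_mul_inv _ q.conjExponent, ← hconj.one_sub_inv, one_div]
    ring
  refine le_antisymm ((div_le_div_iff_of_pos_right hconj.symm.pos).1 ?_)
    ((div_le_div_iff_of_pos_right hconj.symm.pos).1 ?_)
  · refine norm_rpow_conjExponent_div_le hq fun v => ?_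
    have hv : 1 / q * ‖u‖ ^ q - Φ u ≤ 1 / q * ‖v‖ ^ q - Φ v := h (Set.mem_univ v)
    linarith
  · have hyoung := Real.young_inequality_of_nonneg (norm_nonneg Φ) (norm_nonneg u) hconj.symm
    have hle : ‖u‖ ^ q ≤ ‖Φ‖ * ‖u‖ := hself ▸ (le_abs_self _).trans (Φ.le_opNorm u)
    rw [div_eq_inv_mul _ q, ← one_div] at hyoung
    linarith

theorem apply_nonneg_of_isMinOn (hq : 0 < q)
    (h : IsMinOn (fun v => 1 / q * ‖v‖ ^ q - Φ v) Set.univ u) {v : E}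
    (hv : LineDifferentiableAt ℝ (fun w : E => ‖w‖ ^ q) u v)
    (hle : ∀ t : ℝ, 0 ≤ t → ‖u‖ ≤ ‖u + t • v‖) : 0 ≤ Φ v := by
  suffices 0 ≤ lineDeriv ℝ (fun w : E => ‖w‖ ^ q) u v by
    rw [lineDeriv_eq_apply_of_isMinOn hq.ne' h hv] at this
    exact nonneg_of_mul_nonneg_right this hq
  refine ge_of_tendsto (hv.hasLineDerivAt.tendsto_slope_zero_right) ?_
  filter_upwards [self_mem_nhdsWithin] with t ht
  have ht' : 0 < t := ht
  have := Real.rpow_le_rpow (norm_nonneg u) (hle t ht'.le) hq.le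
  simp only [smul_eq_mul]
  exact mul_nonneg (inv_nonneg.2 ht'.le) (sub_nonneg.2 this)

end NormPower

section MidpointDefect

theorem exists_forall_le_mul_of_isCompact {X : Type*} [TopologicalSpace X] {K : Set X}
    (hK : IsCompact K) {f g : X → ℝ} (hf : Continuous f) (hg : Continuous g)
    (hg0 : ∀ z ∈ K, 0 ≤ g z) (hneg : ∀ z ∈ K, g z = 0 → f z < 0) :
    ∃ C, 0 < C ∧ ∀ z ∈ K, f z ≤ C * g z := by
  set Z : Set X := K ∩ {z | 0 ≤ f z}
  have hgZ : ∀ z ∈ Z, 0 < g z := fun z hz =>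
    (hg0 z hz.1).lt_of_ne fun h => hz.2.not_gt (hneg z hz.1 h.symm)
  obtain ⟨C, hC⟩ := (hK.inter_right (isClosed_le continuous_const hf)).bddAbove_image
    (f := fun z => f z / g z) (hf.continuousOn.div hg.continuousOn fun z hz => (hgZ z hz).ne')
  refine ⟨max C 1, by positivity, fun z hz => ?_⟩
  by_cases hfz : 0 ≤ f z
  · have hle := hC (Set.mem_image_of_mem _ ⟨hz, hfz⟩)
    exact (div_le_iff₀ (hgZ z ⟨hz, hfz⟩)).1 (hle.trans (le_max_left C 1))
  · exact (not_le.1 hfz).le.trans (mul_nonneg (by positivity) (hg0 z hz))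

variable {q : ℝ}

/-- The defect in the midpoint convexity of `t ↦ |t| ^ q`. Its positivity off the diagonal is the
source of the uniform convexity of `L^q`. -/
noncomputable def midpointDefect (q a b : ℝ) : ℝ :=
  (|a| ^ q + |b| ^ q) / 2 - |(a + b) / 2| ^ q

theorem midpointDefect_pos (hq : 1 < q) {a b : ℝ} (hab : a ≠ b) : 0 < midpointDefect q a b := by
  rw [midpointDefect, sub_pos]
  by_cases h : |a| = |b|
  · obtain rfl : a = -b := (abs_eq_abs.1 h).resolve_left hab
    have hb : b ≠ 0 := fun hb => hab (by simp [hb])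
    have hpos : 0 < |b| ^ q := Real.rpow_pos_of_pos (abs_pos.2 hb) q
    simpa [Real.zero_rpow (zero_lt_one.trans hq).ne'] using hpos
  · have hconv := (strictConvexOn_rpow hq).2 (abs_nonneg a) (abs_nonneg b) h
      (by norm_num : (0 : ℝ) < 1 / 2) (by norm_num : (0 : ℝ) < 1 / 2) (by norm_num)
    simp only [smul_eq_mul] at hconv
    calc |(a + b) / 2| ^ q ≤ (1 / 2 * |a| + 1 / 2 * |b|) ^ q := by
          gcongr
          rw [abs_div, abs_two]
          linarith [abs_add_le a b]
      _ < (|a| ^ q + |b| ^ q) / 2 := by linarith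

theorem midpointDefect_self (q a : ℝ) : midpointDefect q a a = 0 := by
  rw [midpointDefect, add_self_div_two, add_self_div_two, sub_self]

theorem midpointDefect_nonneg (hq : 1 < q) (a b : ℝ) : 0 ≤ midpointDefect q a b := by
  rcases eq_or_ne a b with rfl | hab
  · rw [midpointDefect_self]
  · exact (midpointDefect_pos hq hab).le

theorem continuous_midpointDefect (hq : 0 ≤ q) :
    Continuous fun z : ℝ × ℝ => midpointDefect q z.1 z.2 := by
  unfold midpointDefect
  fun_prop (disch := exact fun _ => Or.inr hq)

theorem rpow_abs_mul {r : ℝ} (hr : 0 ≤ r) (q t : ℝ) : |r * t| ^ q = r ^ q * |t| ^ q := by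
  rw [abs_mul, abs_of_nonneg hr, Real.mul_rpow hr (abs_nonneg t)]

theorem midpointDefect_mul {r : ℝ} (hr : 0 ≤ r) (q a b : ℝ) :
    midpointDefect q (r * a) (r * b) = r ^ q * midpointDefect q a b := by
  simp only [midpointDefect, ← mul_add, mul_div_assoc, rpow_abs_mul hr]
  ring

-- All terms are homogeneous of degree `q`, so a bound on the compact unit sphere suffices.
theorem exists_rpow_abs_sub_le (hq : 1 < q) {ε : ℝ} (hε : 0 < ε) :
    ∃ C, 0 < C ∧ ∀ a b : ℝ,
      |a - b| ^ q ≤ ε * (|a| ^ q + |b| ^ q) + C * midpointDefect q a b := by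
  have hq0 : 0 < q := zero_lt_one.trans hq
  have hpow : Continuous fun t : ℝ => |t| ^ q :=
    continuous_abs.rpow_const fun _ => Or.inr hq0.le
  obtain ⟨C, hC, h⟩ := exists_forall_le_mul_of_isCompact (isCompact_sphere (0 : ℝ × ℝ) 1)
    (f := fun z => |z.1 - z.2| ^ q - ε * (|z.1| ^ q + |z.2| ^ q))
    (g := fun z => midpointDefect q z.1 z.2)
    ((hpow.comp (continuous_fst.sub continuous_snd)).sub
      (((hpow.comp continuous_fst).add (hpow.comp continuous_snd)).const_mul ε))
    (continuous_midpointDefect hq0.le)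
    (fun z _ => midpointDefect_nonneg hq z.1 z.2) (by
      rintro ⟨a, b⟩ hz hab
      obtain rfl : a = b := by
        by_contra hne
        exact (midpointDefect_pos hq hne).ne' hab
      have ha : a ≠ 0 := by
        rintro rfl
        simp at hz
      have hpos : 0 < |a| ^ q := Real.rpow_pos_of_pos (abs_pos.2 ha) q
      simpa [Real.zero_rpow hq0.ne'] using mul_pos hε (add_pos hpos hpos))
  refine ⟨C, hC, fun a b => ?_⟩
  rcases eq_or_ne ((a, b) : ℝ × ℝ) 0 with h0 | h0
  · obtain ⟨rfl, rfl⟩ := Prod.mk_eq_zero.1 h0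
    simp [Real.zero_rpow hq0.ne', midpointDefect_self]
  have hr : 0 < ‖((a, b) : ℝ × ℝ)‖⁻¹ := inv_pos.2 (norm_pos_iff.2 h0)
  have hab := h (‖((a, b) : ℝ × ℝ)‖⁻¹ • (a, b))
    (mem_sphere_zero_iff_norm.2 (norm_smul_inv_norm h0))
  simp only [Prod.smul_mk, smul_eq_mul, ← mul_sub, rpow_abs_mul hr.le,
    midpointDefect_mul hr.le] at hab
  refine le_of_mul_le_mul_left ?_ (Real.rpow_pos_of_pos hr q)
  linarith

theorem uniformConvexSpace_of_rpow_norm_sub_le {E : Type*} [NormedAddCommGroup E]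
    [NormedSpace ℝ E] (hq : 1 ≤ q)
    (h : ∀ ε > 0, ∃ C > 0, ∀ x y : E, ‖x - y‖ ^ q ≤
      ε * (‖x‖ ^ q + ‖y‖ ^ q) + C * ((‖x‖ ^ q + ‖y‖ ^ q) / 2 - ‖(1 / 2 : ℝ) • (x + y)‖ ^ q)) :
    UniformConvexSpace E := by
  refine ⟨fun η hη => ?_⟩
  obtain ⟨C, hC, h⟩ := h (η ^ q / 4) (by positivity)
  refine ⟨η ^ q / (C * q), by positivity, fun x hx y hy hxy => ?_⟩
  have hdefect := h x y
  rw [norm_smul_of_nonneg (by norm_num), hx, hy, Real.one_rpow] at hdefect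
  have hη_le : η ^ q ≤ ‖x - y‖ ^ q := Real.rpow_le_rpow hη.le hxy (by linarith)
  have hbernoulli := one_add_mul_self_le_rpow_one_add
    (s := 1 / 2 * ‖x + y‖ - 1) (by linarith [norm_nonneg (x + y)]) hq
  rw [add_sub_cancel] at hbernoulli
  have hC_mul := mul_le_mul_of_nonneg_left hbernoulli hC.le
  suffices η ^ q / (C * q) ≤ 2 - ‖x + y‖ by linarith
  rw [div_le_iff₀ (by positivity)]
  linarith

end MidpointDefect

section LpProduct

variable {α : Type*} [MeasurableSpace α] {μ : Measure α} {p : ℝ≥0∞}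

theorem one_lt_toReal (hp1 : 1 < p) (hp : p < ⊤) : 1 < p.toReal := by
  simpa using (ENNReal.toReal_lt_toReal ENNReal.one_ne_top hp.ne).2 hp1

theorem integrable_rpow_abs (hp1 : 1 < p) (hp : p < ⊤) (f : Lp ℝ p μ) :
    Integrable (fun x => |f x| ^ p.toReal) μ :=
  (Lp.memLp f).integrable_norm_rpow (zero_lt_one.trans hp1).ne' hp.ne

theorem norm_rpow_lp_eq (hp1 : 1 < p) (hp : p < ⊤) (f : Lp ℝ p μ) :
    ‖f‖ ^ p.toReal = ∫ x, |f x| ^ p.toReal ∂μ := by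
  have h0 : 0 ≤ ∫ x, ‖f x‖ ^ p.toReal ∂μ := integral_nonneg fun x => by positivity
  rw [Lp.norm_def, (Lp.memLp f).eLpNorm_eq_integral_rpow_norm (zero_lt_one.trans hp1).ne' hp.ne,
    ENNReal.toReal_ofReal (by positivity),
    Real.rpow_inv_rpow h0 (zero_lt_one.trans (one_lt_toReal hp1 hp)).ne']
  rfl

theorem hasDerivAt_integral_rpow_norm_add_smul {H : Type*} [NormedAddCommGroup H]
    [InnerProductSpace ℝ H] (hp1 : 1 < p) (hp : p < ⊤) {f g : α → H} (hf : MemLp f p μ)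
    (hg : MemLp g p μ) :
    HasDerivAt (fun t : ℝ => ∫ x, ‖f x + t • g x‖ ^ p.toReal ∂μ)
      (∫ x, fderiv ℝ (fun h : H => ‖h‖ ^ p.toReal) (f x) (g x) ∂μ) 0 := by
  have hq := one_lt_toReal hp1 hp
  have hp0 := (zero_lt_one.trans hp1).ne'
  set q := p.toReal
  set G : H → ℝ := fun h => ‖h‖ ^ q
  have hG : Differentiable ℝ G := differentiable_norm_rpow hq
  have hmeas : ∀ t : ℝ, AEStronglyMeasurable (fun x => f x + t • g x) μ := fun t =>
    hf.1.add (hg.1.const_smul t)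
  have hbound : ∀ x, ∀ t ∈ Metric.ball (0 : ℝ) 1,
      ‖fderiv ℝ G (f x + t • g x) (g x)‖ ≤ q * (‖f x‖ + ‖g x‖) ^ q := fun x t ht => by
    have ht : ‖t‖ ≤ 1 := (mem_ball_zero_iff.1 ht).le
    have hle : ‖f x + t • g x‖ ≤ ‖f x‖ + ‖g x‖ := (norm_add_le _ _).trans (by
      rw [norm_smul]
      gcongr
      exact mul_le_of_le_one_left (norm_nonneg _) ht)
    calc ‖fderiv ℝ G (f x + t • g x) (g x)‖ ≤ q * ‖f x + t • g x‖ ^ (q - 1) * ‖g x‖ :=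
          (norm_fderiv_norm_id_rpow (f x + t • g x) hq) ▸ ContinuousLinearMap.le_opNorm _ _
      _ ≤ q * (‖f x‖ + ‖g x‖) ^ (q - 1) * (‖f x‖ + ‖g x‖) := by
          gcongr
          exact le_add_of_nonneg_left (norm_nonneg (f x))
      _ = q * (‖f x‖ + ‖g x‖) ^ q := by
          rw [mul_assoc, ← Real.rpow_add_one' (by positivity) (by linarith), sub_add_cancel]
  have hdom : Integrable (fun x => (‖f x‖ + ‖g x‖) ^ q) μ := by
    refine ((hf.norm.add hg.norm).integrable_norm_rpow hp0 hp.ne).congr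
      (Eventually.of_forall fun x => ?_)
    simp only [Pi.add_apply, Real.norm_of_nonneg (add_nonneg (norm_nonneg _) (norm_nonneg _)), q]
  have hderiv := (hasDerivAt_integral_of_dominated_loc_of_deriv_le (𝕜 := ℝ) (x₀ := 0)
    (F := fun t x => G (f x + t • g x))
    (F' := fun t x => fderiv ℝ G (f x + t • g x) (g x)) (Metric.ball_mem_nhds 0 one_pos)
    (Eventually.of_forall fun t => hG.continuous.comp_aestronglyMeasurable (hmeas t))
    (by simpa using hf.integrable_norm_rpow hp0 hp.ne)
    (((contDiff_norm_rpow hq).continuous_fderiv_apply one_ne_zero).comp_aestronglyMeasurable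
      ((hmeas 0).prodMk hg.1))
    (Eventually.of_forall hbound)
    (hdom.const_mul q)
    (Eventually.of_forall fun x t _ => (hG _).hasFDerivAt.comp_hasDerivAt t
      (by simpa using ((hasDerivAt_id t).smul_const (g x)).const_add (f x)))).2
  simpa only [zero_smul, add_zero] using hderiv

variable {ι : Type*} [Fintype ι] [Fact (1 ≤ p)]

theorem norm_rpow_piLp_eq (hp1 : 1 < p) (hp : p < ⊤) (w : PiLp p fun _ : ι => Lp ℝ p μ) :
    ‖w‖ ^ p.toReal = ∑ j, ∫ x, |w j x| ^ p.toReal ∂μ := by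
  have hq : 0 < p.toReal := zero_lt_one.trans (one_lt_toReal hp1 hp)
  rw [PiLp.norm_eq_sum hq, one_div,
    Real.rpow_inv_rpow (Finset.sum_nonneg fun _ _ => by positivity) hq.ne']
  exact Finset.sum_congr rfl fun j _ => norm_rpow_lp_eq hp1 hp _

theorem uniformConvexSpace_piLp (hp1 : 1 < p) (hp : p < ⊤) :
    UniformConvexSpace (PiLp p fun _ : ι => Lp ℝ p μ) := by
  have hq := one_lt_toReal hp1 hp
  refine uniformConvexSpace_of_rpow_norm_sub_le hq.le fun ε hε => ?_
  obtain ⟨C, hC, h⟩ := exists_rpow_abs_sub_le hq hε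
  refine ⟨C, hC, fun v w => ?_⟩
  have hint := fun f : Lp ℝ p μ => integrable_rpow_abs hp1 hp f
  simp only [norm_rpow_piLp_eq hp1 hp]
  rw [← Finset.sum_add_distrib, Finset.mul_sum, Finset.sum_div, ← Finset.sum_sub_distrib,
    Finset.mul_sum, ← Finset.sum_add_distrib]
  refine Finset.sum_le_sum fun j _ => ?_
  have hsum := (hint (v j)).fun_add (hint (w j))
  have hmid := hint (((1 / 2 : ℝ) • (v + w)) j)
  have hdefect : Integrable (fun x => (|v j x| ^ p.toReal + |w j x| ^ p.toReal) / 2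
      - |((1 / 2 : ℝ) • (v + w)) j x| ^ p.toReal) μ := (hsum.div_const 2).sub hmid
  rw [← integral_add (hint _) (hint _), ← integral_const_mul, ← integral_div,
    ← integral_sub (hsum.div_const 2) hmid, ← integral_const_mul,
    ← integral_add (hsum.const_mul ε) (hdefect.const_mul C)]
  refine integral_mono_ae (hint _) ((hsum.const_mul ε).fun_add (hdefect.const_mul C)) ?_
  filter_upwards [Lp.coeFn_sub (v j) (w j), Lp.coeFn_add (v j) (w j),
    Lp.coeFn_smul (1 / 2 : ℝ) (v j + w j)] with x hsub hadd hsmul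
  have hsub' : (v - w) j x = v j x - w j x := hsub
  have hmid' : ((1 / 2 : ℝ) • (v + w)) j x = (v j x + w j x) / 2 := by
    rw [PiLp.smul_apply, PiLp.add_apply, hsmul, Pi.smul_apply, hadd, Pi.add_apply, smul_eq_mul]
    ring
  simpa only [hsub', hmid', midpointDefect] using h (v j x) (w j x)

theorem lineDifferentiableAt_rpow_norm_piLp (hp1 : 1 < p) (hp : p < ⊤)
    (u v : PiLp p fun _ : ι => Lp ℝ p μ) :
    LineDifferentiableAt ℝ (fun w => ‖w‖ ^ p.toReal) u v := by
  have hsum : DifferentiableAt ℝ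
      (fun t : ℝ => ∑ j, ∫ x, ‖u j x + t • v j x‖ ^ p.toReal ∂μ) 0 :=
    DifferentiableAt.fun_sum fun j _ => (hasDerivAt_integral_rpow_norm_add_smul hp1 hp
      (Lp.memLp (u j)) (Lp.memLp (v j))).differentiableAt
  refine hsum.congr_of_eventuallyEq (Eventually.of_forall fun t => ?_)
  simp only [norm_rpow_piLp_eq hp1 hp]
  refine Finset.sum_congr rfl fun j _ => integral_congr_ae ?_
  filter_upwards [Lp.coeFn_add (u j) (t • v j), Lp.coeFn_smul t (v j)] with x hadd hsmul
  rw [PiLp.add_apply, PiLp.smul_apply, hadd, Pi.add_apply, hsmul, Pi.smul_apply, Real.norm_eq_abs]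

end LpProduct

section Mollification

theorem exists_seq_contDiffBump_rOut {E : Type*} [NormedAddCommGroup E] {δ : ℝ}
    (hδ : 0 < δ) :
    ∃ ρ : ℕ → ContDiffBump (0 : E),
      (∀ n, (ρ n).rOut ≤ δ) ∧ Tendsto (fun n => (ρ n).rOut) atTop (𝓝 0) := by
  refine ⟨fun n => ⟨δ / (n + 1) / 2, δ / (n + 1), by positivity, half_lt_self (by positivity)⟩,
    fun n => div_le_self hδ.le (by linarith [Nat.cast_nonneg (α := ℝ) n]), ?_⟩
  simpa [div_eq_mul_inv] using
    (tendsto_one_div_add_atTop_nhds_zero_nat (𝕜 := ℝ)).const_mul δ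

open ContinuousLinearMap (lsmul)
open scoped Convolution

variable {E : Type*} [NormedAddCommGroup E] [NormedSpace ℝ E] [FiniteDimensional ℝ E]
  [MeasurableSpace E] [BorelSpace E] {μ : Measure E} [μ.IsAddHaarMeasure]

/-- The mollification of `f` by the normalized bump function `ρ`. It gives the smooth
approximations from which the chain rule for weak derivatives is obtained. -/
noncomputable def mollify (μ : Measure E) (ρ : ContDiffBump (0 : E)) (f : E → ℝ) : E → ℝ :=
  ρ.normed μ ⋆[lsmul ℝ ℝ, μ] f

variable (ρ : ContDiffBump (0 : E)) {f k : E → ℝ}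

theorem contDiff_mollify (hf : LocallyIntegrable f μ) : ContDiff ℝ ∞ (mollify μ ρ f) :=
  ρ.hasCompactSupport_normed.contDiff_convolution_left (lsmul ℝ ℝ) ρ.contDiff_normed hf

theorem abs_mollify_le {B : ℝ} (hf : ∀ x, |f x| ≤ B) (x : E) : |mollify μ ρ f x| ≤ B := by
  have h := norm_integral_le_of_norm_le (μ := μ)
    (f := fun t => lsmul ℝ ℝ (ρ.normed μ t) (f (x - t)))
    (ρ.integrable_normed.mul_const B) (Eventually.of_forall fun t => by
      simp only [ContinuousLinearMap.lsmul_apply, smul_eq_mul, norm_mul, Real.norm_eq_abs,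
        abs_of_nonneg (ρ.nonneg_normed t)]
      exact mul_le_mul_of_nonneg_left (hf _) (ρ.nonneg_normed t))
  rwa [integral_mul_const, ρ.integral_normed, one_mul] at h

theorem integral_mul_mollify (hf : Integrable f μ) (hk : Integrable k μ) :
    ∫ x, f x * mollify μ ρ k x ∂μ = ∫ x, mollify μ ρ f x * k x ∂μ := by
  have hρ : Continuous (ρ.normed μ) := ρ.continuous_normed
  obtain ⟨C, hC⟩ := hρ.bounded_above_of_compact_support ρ.hasCompactSupport_normed
  simp only [mollify, convolution_eq_swap, ContinuousLinearMap.lsmul_apply, smul_eq_mul,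
    ← integral_const_mul, ← integral_mul_const]
  rw [integral_integral_swap]
  · refine integral_congr_ae (Eventually.of_forall fun t => integral_congr_ae
      (Eventually.of_forall fun x => ?_))
    simp only
    rw [← ρ.normed_neg (x - t), neg_sub]
    ring
  · refine ((hf.mul_prod hk).bdd_mul (c := C) (f := fun z : E × E => ρ.normed μ (z.1 - z.2))
      (hρ.comp (continuous_fst.sub continuous_snd)).aestronglyMeasurable
      (Eventually.of_forall fun z => hC _)).congr (Eventually.of_forall fun z => ?_)
    simp only [Function.uncurry]
    ring

theorem tsupport_mollify_subset {δ : ℝ} (hδ : ρ.rOut ≤ δ) :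
    tsupport (mollify μ ρ f) ⊆ Metric.cthickening δ (tsupport f) := by
  refine closure_minimal ((support_convolution_subset (lsmul ℝ ℝ)).trans ?_)
    Metric.isClosed_cthickening
  rintro _ ⟨a, ha, b, hb, rfl⟩
  rw [ρ.support_normed_eq, mem_ball_zero_iff] at ha
  refine Metric.mem_cthickening_of_dist_le _ b δ _ (subset_tsupport f hb) ?_
  rw [dist_eq_norm, add_sub_cancel_right]
  exact ha.le.trans hδ

theorem fderiv_mollify_apply (hf : ContDiff ℝ 1 f) (hc : HasCompactSupport f) (x v : E) :
    fderiv ℝ (mollify μ ρ f) x v = mollify μ ρ (fun y => fderiv ℝ f y v) x := by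
  have hρ : LocallyIntegrable (ρ.normed μ) μ := ρ.continuous_normed.locallyIntegrable
  rw [mollify, (hc.hasFDerivAt_convolution_right (lsmul ℝ ℝ) hρ hf x).fderiv]
  exact convolution_precompR_apply (lsmul ℝ ℝ) hρ (hc.fderiv ℝ)
    (hf.continuous_fderiv one_ne_zero) x v

theorem integral_mul_fderiv_eq_neg (hf : ContDiff ℝ 1 f) (hk : ContDiff ℝ 1 k)
    (hc : HasCompactSupport k) (v : E) :
    ∫ x, f x * fderiv ℝ k x v ∂μ = -∫ x, fderiv ℝ f x v * k x ∂μ := by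
  have hf' := (hf.continuous_fderiv one_ne_zero).clm_apply (continuous_const (y := v))
  have hk' := (hk.continuous_fderiv one_ne_zero).clm_apply (continuous_const (y := v))
  exact integral_mul_fderiv_eq_neg_fderiv_mul_of_integrable
    ((hf'.mul hk.continuous).integrable_of_hasCompactSupport hc.mul_left)
    ((hf.continuous.mul hk').integrable_of_hasCompactSupport (hc.fderiv_apply ℝ v).mul_left)
    ((hf.continuous.mul hk.continuous).integrable_of_hasCompactSupport hc.mul_left)
    (fun x _ => (hf.differentiable one_ne_zero).differentiableAt)
    (fun x _ => (hk.differentiable one_ne_zero).differentiableAt)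

end Mollification

section ChainRule

variable {N : ℕ} {Ω : Set (EuclideanSpace ℝ (Fin N))} {i : Fin N}
  {u g φ : EuclideanSpace ℝ (Fin N) → ℝ} {H : ℝ → ℝ} {B δ : ℝ}

theorem setIntegral_mul_fderiv_eq_integral (hφΩ : tsupport φ ⊆ Ω)
    (v : EuclideanSpace ℝ (Fin N)) :
    ∫ x in Ω, u x * fderiv ℝ φ x v = ∫ x, u x * fderiv ℝ φ x v :=
  setIntegral_eq_integral_of_forall_compl_eq_zero fun x hx => by
    rw [image_eq_zero_of_notMem_tsupport (f := fun y => fderiv ℝ φ y v)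
      (fun hx' => hx (hφΩ (tsupport_fderiv_apply_subset ℝ v hx'))), mul_zero]

theorem IsWeakPartial.integral_mollify_mul_fderiv (hw : IsWeakPartial Ω i u g)
    (hu : Integrable u) (hφ : ContDiff ℝ ∞ φ) (hc : HasCompactSupport φ)
    (hδ : Metric.cthickening δ (tsupport φ) ⊆ Ω)
    {ρ : ContDiffBump (0 : EuclideanSpace ℝ (Fin N))} (hρ : ρ.rOut ≤ δ) :
    ∫ x, mollify volume ρ u x * fderiv ℝ φ x (EuclideanSpace.single i 1)
      = -∫ x in Ω, g x * mollify volume ρ φ x := by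
  have hψΩ : tsupport (mollify volume ρ φ) ⊆ Ω := (tsupport_mollify_subset ρ hρ).trans hδ
  rw [← hw _ (contDiff_mollify ρ hφ.continuous.locallyIntegrable)
    (ρ.hasCompactSupport_normed.convolution _ hc) hψΩ, setIntegral_mul_fderiv_eq_integral hψΩ,
    ← integral_mul_mollify ρ hu ((continuous_partial hφ _).integrable_of_hasCompactSupport
      (hc.fderiv_apply ℝ _))]
  simp only [fderiv_mollify_apply ρ (hφ.of_le (by simp)) hc]

theorem IsWeakPartial.integral_comp_mollify_mul_fderiv (hw : IsWeakPartial Ω i u g)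
    (hu : Integrable u) (hH : ContDiff ℝ ∞ H) (hφ : ContDiff ℝ ∞ φ) (hc : HasCompactSupport φ)
    (hδ : Metric.cthickening δ (tsupport φ) ⊆ Ω)
    {ρ : ContDiffBump (0 : EuclideanSpace ℝ (Fin N))} (hρ : ρ.rOut ≤ δ) :
    ∫ x, H (mollify volume ρ u x) * fderiv ℝ φ x (EuclideanSpace.single i 1)
      = -∫ x in Ω, g x *
        mollify volume ρ (fun y => deriv H (mollify volume ρ u y) * φ y) x := by
  set v : EuclideanSpace ℝ (Fin N) := EuclideanSpace.single i 1
  set w := mollify volume ρ u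
  have hw_smooth : ContDiff ℝ ∞ w := contDiff_mollify ρ hu.locallyIntegrable
  have hH' : ContDiff ℝ ∞ (deriv H) := by simpa using hH.iterate_deriv 1
  have hψ : ContDiff ℝ ∞ fun y => deriv H (w y) * φ y := (hH'.comp hw_smooth).mul hφ
  have hψc : HasCompactSupport fun y => deriv H (w y) * φ y := hc.mul_left
  rw [← hw.integral_mollify_mul_fderiv hu hψ hψc
    ((Metric.cthickening_subset_of_subset δ tsupport_mul_subset_right).trans hδ) hρ,
    integral_mul_fderiv_eq_neg (hw_smooth.of_le (by simp)) (hψ.of_le (by simp)) hψc]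
  refine (integral_mul_fderiv_eq_neg ((hH.comp hw_smooth).of_le (by simp)) (hφ.of_le (by simp))
    hc v).trans ?_
  congr 2 with x
  rw [(((hH.differentiable (by simp)) (w x)).hasDerivAt.comp_hasFDerivAt x
    ((hw_smooth.differentiable (by simp)) x).hasFDerivAt).fderiv, smul_apply, smul_eq_mul]
  ring

variable {ρ : ℕ → ContDiffBump (0 : EuclideanSpace ℝ (Fin N))} {F : ℝ → ℝ}

theorem tendsto_uncurry_mollify (hρ : Tendsto (fun n => (ρ n).rOut) atTop (𝓝 0))
    (hu : Integrable u) {x : EuclideanSpace ℝ (Fin N)} (hx : ContinuousAt u x) :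
    Tendsto (fun z : ℕ × EuclideanSpace ℝ (Fin N) => mollify volume (ρ z.1) u z.2)
      (atTop ×ˢ 𝓝 x) (𝓝 (u x)) :=
  ContDiffBump.convolution_tendsto_right (g := fun _ => u) (hρ.comp tendsto_fst)
    (Eventually.of_forall fun _ => hu.aestronglyMeasurable) (hx.tendsto.comp tendsto_snd)
    tendsto_snd

theorem exists_forall_abs_comp_mollify_le (hB : ∀ x, |u x| ≤ B) (hF : Continuous F) :
    ∃ M, 0 ≤ M ∧ ∀ n x, |F (mollify volume (ρ n) u x)| ≤ M := by
  obtain ⟨M, hM⟩ := isCompact_Icc.exists_bound_of_continuousOn (hF.continuousOn (s := .Icc (-B) B))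
  have hbound : ∀ n x, |F (mollify volume (ρ n) u x)| ≤ M := fun n x =>
    hM _ (abs_le.1 (abs_mollify_le (ρ n) hB x))
  exact ⟨M, (abs_nonneg _).trans (hbound 0 0), hbound⟩

theorem tendsto_integral_comp_mollify_mul (hΩ : IsOpen Ω)
    (hρ : Tendsto (fun n => (ρ n).rOut) atTop (𝓝 0)) (hu : Integrable u)
    (huc : ContinuousOn u Ω) (hB : ∀ x, |u x| ≤ B) (hF : Continuous F) (hφ : Continuous φ)
    (hc : HasCompactSupport φ) (hφΩ : tsupport φ ⊆ Ω) :
    Tendsto (fun n => ∫ x, F (mollify volume (ρ n) u x) * φ x) atTop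
      (𝓝 (∫ x, F (u x) * φ x)) := by
  obtain ⟨M, -, hM⟩ := exists_forall_abs_comp_mollify_le (ρ := ρ) hB hF
  refine tendsto_integral_of_dominated_convergence (fun x => M * ‖φ x‖) (fun n =>
    ((hF.comp (contDiff_mollify (ρ n) hu.locallyIntegrable).continuous).mul
      hφ).aestronglyMeasurable) (((hφ.integrable_of_hasCompactSupport hc).norm).const_mul M)
    (fun n => Eventually.of_forall fun x => ?_) (Eventually.of_forall fun x => ?_)
  · rw [norm_mul]
    gcongr
    exact hM n x
  · by_cases hx : x ∈ Ω
    · exact ((hF.tendsto (u x)).comp ((tendsto_uncurry_mollify hρ hu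
        (huc.continuousAt (hΩ.mem_nhds hx))).comp
          (tendsto_id.prodMk tendsto_const_nhds))).mul_const _
    · simp [image_eq_zero_of_notMem_tsupport fun hx' => hx (hφΩ hx')]

theorem tendsto_setIntegral_mul_mollify_comp (hΩ : IsOpen Ω)
    (hρ : Tendsto (fun n => (ρ n).rOut) atTop (𝓝 0)) (hρδ : ∀ n, (ρ n).rOut ≤ δ)
    (hu : Integrable u) (huc : ContinuousOn u Ω) (hB : ∀ x, |u x| ≤ B)
    (hg : LocallyIntegrable g (volume.restrict Ω)) (hF : Continuous F) (hφ : Continuous φ)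
    (hc : HasCompactSupport φ) :
    Tendsto (fun n => ∫ x in Ω, g x * mollify volume (ρ n)
        (fun y => F (mollify volume (ρ n) u y) * φ y) x) atTop
      (𝓝 (∫ x in Ω, F (u x) * g x * φ x)) := by
  obtain ⟨C, hC⟩ := hφ.bounded_above_of_compact_support hc
  obtain ⟨M, hM0, hM⟩ := exists_forall_abs_comp_mollify_le (ρ := ρ) hB hF
  set ψ := fun n y => F (mollify volume (ρ n) u y) * φ y
  have hψ : ∀ n, Continuous (ψ n) := fun n =>
    (hF.comp (contDiff_mollify (ρ n) hu.locallyIntegrable).continuous).mul hφ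
  have hψM : ∀ n y, |ψ n y| ≤ M * C := fun n y =>
    (abs_mul _ _).trans_le (mul_le_mul (hM n y) (hC y) (abs_nonneg _) hM0)
  set K := Metric.cthickening δ (tsupport φ)
  have hK : IsCompact K := hc.isCompact.cthickening
  have hsupp : ∀ n, ∀ x ∉ K, mollify volume (ρ n) (ψ n) x = 0 := fun n x hx =>
    image_eq_zero_of_notMem_tsupport fun hx' => hx (Metric.cthickening_subset_of_subset δ
      tsupport_mul_subset_right (tsupport_mollify_subset (ρ n) (hρδ n) hx'))
  have hgK : Integrable (K.indicator g) (volume.restrict Ω) :=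
    (hg.integrableOn_isCompact hK).integrable_indicator hK.measurableSet
  refine tendsto_integral_of_dominated_convergence (fun x => ‖K.indicator g x‖ * (M * C))
    (fun n => hg.aestronglyMeasurable.mul
      (contDiff_mollify (ρ n) (hψ n).locallyIntegrable).continuous.aestronglyMeasurable)
    (hgK.norm.mul_const (M * C)) (fun n => Eventually.of_forall fun x => ?_) ?_
  · by_cases hx : x ∈ K
    · rw [norm_mul, Set.indicator_of_mem hx]
      gcongr
      exact abs_mollify_le (ρ n) (hψM n) x
    · rw [show mollify volume (ρ n) (fun y => F (mollify volume (ρ n) u y) * φ y) x = 0 from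
        hsupp n x hx, Set.indicator_of_notMem hx, mul_zero, norm_zero, zero_mul]
  · filter_upwards [ae_restrict_mem hΩ.measurableSet] with x hx
    rw [mul_right_comm, mul_comm _ (g x)]
    refine Tendsto.const_mul (g x) (ContDiffBump.convolution_tendsto_right hρ
      (Eventually.of_forall fun n => (hψ n).aestronglyMeasurable) ?_ tendsto_const_nhds)
    exact ((hF.tendsto (u x)).comp (tendsto_uncurry_mollify hρ hu
      (huc.continuousAt (hΩ.mem_nhds hx)))).mul ((hφ.tendsto x).comp tendsto_snd)

-- The classical chain rule holds for the mollifications of `u`. They are tested against the weak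
-- derivative of `u` by moving the mollifier to the test function, whose support stays in `Ω`.
theorem IsWeakPartial.comp (hΩ : IsOpen Ω) (hu : Integrable u) (huc : ContinuousOn u Ω)
    (hB : ∀ x, |u x| ≤ B) (hg : LocallyIntegrable g (volume.restrict Ω))
    (hw : IsWeakPartial Ω i u g) (hH : ContDiff ℝ ∞ H) :
    IsWeakPartial Ω i (fun x => H (u x)) (fun x => deriv H (u x) * g x) := by
  intro φ hφ hc hφΩ
  obtain ⟨δ, hδ, hδΩ⟩ := hc.isCompact.exists_cthickening_subset_open hΩ hφΩ
  obtain ⟨ρ, hρδ, hρ⟩ := exists_seq_contDiffBump_rOut (E := EuclideanSpace ℝ (Fin N)) hδ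
  have hleft := tendsto_integral_comp_mollify_mul hΩ hρ hu huc hB hH.continuous
    (continuous_partial hφ _) (hc.fderiv_apply ℝ (EuclideanSpace.single i 1))
    ((tsupport_fderiv_apply_subset ℝ _).trans hφΩ)
  have hright := (tendsto_setIntegral_mul_mollify_comp hΩ hρ hρδ hu huc hB hg
    (hH.continuous_deriv (by simp)) hφ.continuous hc).neg
  rw [setIntegral_mul_fderiv_eq_integral hφΩ]
  exact tendsto_nhds_unique hleft (hright.congr fun n =>
    (hw.integral_comp_mollify_mul_fderiv hu hH hφ hc hδΩ (hρδ n)).symm)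

end ChainRule

section SobolevSpace

variable {N : ℕ} {p : ℝ≥0∞} [Fact (1 ≤ p)] {Ω : Set (EuclideanSpace ℝ (Fin N))}

theorem continuous_setIntegral_Lp_mul {ψ : EuclideanSpace ℝ (Fin N) → ℝ} (hψ : Continuous ψ)
    (hc : HasCompactSupport ψ) :
    Continuous fun f : Lp ℝ p (volume.restrict Ω) => ∫ x in Ω, f x * ψ x := by
  have hconj : p.HolderConjugate (1 - p⁻¹)⁻¹ := by
    rw [ENNReal.holderConjugate_iff, inv_inv]
    exact add_tsub_cancel_of_le (ENNReal.inv_le_one.2 Fact.out)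
  have : Fact (1 ≤ (1 - p⁻¹)⁻¹) := ⟨by simp⟩
  have hm : MemLp ψ (1 - p⁻¹)⁻¹ (volume.restrict Ω) := hψ.memLp_of_hasCompactSupport hc
  refine (((ContinuousLinearMap.mul ℝ ℝ).lpPairing (volume.restrict Ω) p
    (1 - p⁻¹)⁻¹).flip (hm.toLp ψ)).continuous.congr fun f => ?_
  rw [ContinuousLinearMap.flip_apply, ContinuousLinearMap.lpPairing_eq_integral]
  refine integral_congr_ae ?_
  filter_upwards [hm.coeFn_toLp] with x hx
  rw [hx, ContinuousLinearMap.mul_apply']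

theorem isClosed_sobolev :
    IsClosed (Sobolev p Ω : Set (PiLp p fun _ : Option (Fin N) => Lp ℝ p (volume.restrict Ω))) := by
  have h : (Sobolev p Ω : Set (PiLp p fun _ : Option (Fin N) => Lp ℝ p (volume.restrict Ω)))
      = ⋂ (i : Fin N) (φ : EuclideanSpace ℝ (Fin N) → ℝ) (_ : ContDiff ℝ ∞ φ)
        (_ : HasCompactSupport φ) (_ : tsupport φ ⊆ Ω),
        {w | ∫ x in Ω, w none x * fderiv ℝ φ x (EuclideanSpace.single i 1)
          = - ∫ x in Ω, w (some i) x * φ x} := by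
    ext w
    simp only [Set.mem_iInter]
    rfl
  rw [h]
  refine isClosed_iInter fun i => isClosed_iInter fun φ => isClosed_iInter fun hφ =>
    isClosed_iInter fun hc => isClosed_iInter fun _ => isClosed_eq ?_ ?_
  · exact (continuous_setIntegral_Lp_mul (continuous_partial hφ _) (hc.fderiv_apply ℝ _)).comp
      (PiLp.continuous_apply p _ none)
  · exact ((continuous_setIntegral_Lp_mul hφ.continuous hc).comp
      (PiLp.continuous_apply p _ (some i))).neg

/-- The space `W̃^{1,p}(Ω)` as a type of its own. Its instances are those of `TildeSobolev p Ω`, but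
they do not unfold to iterated submodules of a product, which makes unification tractable. -/
def Tilde (p : ℝ≥0∞) [Fact (1 ≤ p)] (Ω : Set (EuclideanSpace ℝ (Fin N))) : Type :=
  TildeSobolev p Ω

noncomputable instance : NormedAddCommGroup (Tilde p Ω) :=
  inferInstanceAs (NormedAddCommGroup (TildeSobolev p Ω))

noncomputable instance : NormedSpace ℝ (Tilde p Ω) :=
  inferInstanceAs (NormedSpace ℝ (TildeSobolev p Ω))

instance : CompleteSpace (Tilde p Ω) :=
  have := (isClosed_sobolev (p := p) (Ω := Ω)).completeSpace_coe
  (ccSobolev p Ω).isClosed_topologicalClosure.completeSpace_coe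

namespace Tilde

/-- The isometric embedding of `W̃^{1,p}(Ω)` into the `ℓ^p`-product of copies of `L^p(Ω)` that
records a function together with its weak derivatives. -/
noncomputable def toPiLp (p : ℝ≥0∞) [Fact (1 ≤ p)] (Ω : Set (EuclideanSpace ℝ (Fin N))) :
    Tilde p Ω →ₗᵢ[ℝ] PiLp p fun _ : Option (Fin N) => Lp ℝ p (volume.restrict Ω) :=
  (Sobolev p Ω).subtypeₗᵢ.comp (TildeSobolev p Ω).subtypeₗᵢ

/-- The element of `L^p(Ω)` underlying an element of `W̃^{1,p}(Ω)`. -/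
noncomputable def toLp (p : ℝ≥0∞) [Fact (1 ≤ p)] (Ω : Set (EuclideanSpace ℝ (Fin N))) :
    Tilde p Ω →L[ℝ] Lp ℝ p (volume.restrict Ω) :=
  (PiLp.proj p (fun _ : Option (Fin N) => Lp ℝ p (volume.restrict Ω)) none).comp
    (toPiLp p Ω).toContinuousLinearMap

theorem norm_toLp_le (u : Tilde p Ω) : ‖toLp p Ω u‖ ≤ ‖u‖ :=
  (PiLp.norm_apply_le (toPiLp p Ω u) none).trans_eq ((toPiLp p Ω).norm_map u)

theorem uniformConvexSpace (hp1 : 1 < p) (hp : p < ⊤) : UniformConvexSpace (Tilde p Ω) :=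
  have := uniformConvexSpace_piLp (ι := Option (Fin N)) (μ := volume.restrict Ω) hp1 hp
  uniformConvexSpace_of_linearIsometry (toPiLp p Ω)

theorem lineDifferentiableAt_rpow_norm (hp1 : 1 < p) (hp : p < ⊤) (u v : Tilde p Ω) :
    LineDifferentiableAt ℝ (fun w : Tilde p Ω => ‖w‖ ^ p.toReal) u v := by
  have h := lineDifferentiableAt_rpow_norm_piLp hp1 hp (toPiLp p Ω u) (toPiLp p Ω v)
  simpa only [LineDifferentiableAt, ← map_smul, ← map_add, LinearIsometry.norm_map] using h

end Tilde

/-- `f` is a version of `u`: it agrees with `u` almost everywhere on `Ω`. This is `AgreesOn` for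
elements of `Tilde p Ω`. -/
def Represents (f : closure Ω → ℝ) (u : Tilde p Ω) : Prop :=
  ∀ᵐ x ∂(volume.restrict Ω), ∀ hx : x ∈ closure Ω, f ⟨x, hx⟩ = Tilde.toLp p Ω u x

theorem Represents.add {f g : closure Ω → ℝ} {u v : Tilde p Ω} (hf : Represents f u)
    (hg : Represents g v) : Represents (f + g) (u + v) :=
  AgreesOn.add (p := p) hf hg

theorem Represents.smul (c : ℝ) {f : closure Ω → ℝ} {u : Tilde p Ω} (hf : Represents f u) :
    Represents (c • f) (c • u) :=
  AgreesOn.smul (p := p) c hf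

theorem Represents.sub {f g : closure Ω → ℝ} {u v : Tilde p Ω} (hf : Represents f u)
    (hg : Represents g v) : Represents (f - g) (u - v) := by
  have := hf.add (hg.smul (-1))
  rwa [neg_one_smul, neg_one_smul, ← sub_eq_add_neg, ← sub_eq_add_neg] at this

theorem Represents.unique (hΩ : IsOpen Ω) {f : closure Ω → ℝ} {u v : Tilde p Ω}
    (hu : Represents f u) (hv : Represents f v) : u = v :=
  Subtype.ext (AgreesOn.unique (p := p) hΩ hu hv)

theorem Tilde.toLp_injective (hΩ : IsOpen Ω) : Function.Injective (toLp p Ω) := by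
  intro u v huv
  refine Represents.unique hΩ (f := fun x => toLp p Ω u x)
    (Eventually.of_forall fun _ _ => rfl) (Eventually.of_forall fun x _ => ?_)
  rw [huv]

end SobolevSpace

section Truncation

variable {N : ℕ} {p : ℝ≥0∞} [Fact (1 ≤ p)] {Ω : Set (EuclideanSpace ℝ (Fin N))}

theorem IsWeakPartial.congr_ae {i : Fin N} {u g u' g' : EuclideanSpace ℝ (Fin N) → ℝ}
    (h : IsWeakPartial Ω i u g) (hu : u =ᵐ[volume.restrict Ω] u')
    (hg : g =ᵐ[volume.restrict Ω] g') : IsWeakPartial Ω i u' g' := fun φ hφ hc hφΩ => by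
  have hu' := integral_congr_ae
    (hu.fun_mul (ae_eq_refl fun x => fderiv ℝ φ x (EuclideanSpace.single i 1)))
  have hg' := integral_congr_ae (hg.fun_mul (ae_eq_refl φ))
  exact hu'.symm.trans ((h φ hφ hc hφΩ).trans (congrArg Neg.neg hg'))

theorem exists_sobolev_ae_eq {F : Option (Fin N) → EuclideanSpace ℝ (Fin N) → ℝ}
    (hm : ∀ j, MemLp (F j) p (volume.restrict Ω))
    (hF : ∀ i, IsWeakPartial Ω i (F none) (F (some i))) :
    ∃ w : Sobolev p Ω, ∀ j, w.1 j =ᵐ[volume.restrict Ω] F j :=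
  ⟨⟨WithLp.toLp p fun j => (hm j).toLp _, fun i => (hF i).congr_ae (hm none).coeFn_toLp.symm
    (hm (some i)).coeFn_toLp.symm⟩, fun j => (hm j).coeFn_toLp⟩

theorem isWeakPartial_fderiv {φ : EuclideanSpace ℝ (Fin N) → ℝ} (hφ : ContDiff ℝ 1 φ)
    (i : Fin N) : IsWeakPartial Ω i φ fun x => fderiv ℝ φ x (EuclideanSpace.single i 1) := by
  intro η hη hc hηΩ
  rw [setIntegral_mul_fderiv_eq_integral hηΩ, integral_mul_fderiv_eq_neg hφ (hη.of_le (by simp)) hc,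
    setIntegral_eq_integral_of_forall_compl_eq_zero fun x hx => by
      rw [image_eq_zero_of_notMem_tsupport fun hx' => hx (hηΩ hx'), mul_zero]]

theorem exists_sobolev_agreesOn_of_contDiff {φ : EuclideanSpace ℝ (Fin N) → ℝ}
    (hφ : ContDiff ℝ 1 φ) (hc : HasCompactSupport φ) :
    ∃ w : Sobolev p Ω, AgreesOn (fun x : closure Ω => φ x) w := by
  obtain ⟨w, hw⟩ := exists_sobolev_ae_eq (p := p) (Ω := Ω)
    (F := fun j => j.elim φ fun i x => fderiv ℝ φ x (EuclideanSpace.single i 1))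
    (by
      rintro (_ | i)
      · exact hφ.continuous.memLp_of_hasCompactSupport hc
      · exact ((hφ.continuous_fderiv one_ne_zero).clm_apply
          continuous_const).memLp_of_hasCompactSupport (hc.fderiv_apply ℝ _))
    fun i => isWeakPartial_fderiv hφ i
  exact ⟨w, (hw none).mono fun x hx _ => hx.symm⟩

theorem AgreesOn.exists_represents {v : C_c(closure Ω, ℝ)} {w : Sobolev p Ω}
    (h : AgreesOn v w) : ∃ u : Tilde p Ω, Represents v u ∧ ‖u‖ = ‖w‖ :=
  ⟨⟨w, (ccSobolev p Ω).le_topologicalClosure ⟨v, h⟩⟩, h, rfl⟩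

/-- The restriction to `closure Ω` of a compactly supported continuous function. Restrictions of
smooth functions are the basic elements of `W^{1,p}(Ω) ∩ C_c(closure Ω)`. -/
def restrictClosure (Ω : Set (EuclideanSpace ℝ (Fin N))) {φ : EuclideanSpace ℝ (Fin N) → ℝ}
    (hφ : Continuous φ) (hc : HasCompactSupport φ) : C_c(closure Ω, ℝ) where
  toFun := fun x => φ x
  continuous_toFun := hφ.comp continuous_subtype_val
  hasCompactSupport' := hc.comp_isClosedEmbedding isClosed_closure.isClosedEmbedding_subtypeVal

theorem exists_represents_restrictClosure {φ : EuclideanSpace ℝ (Fin N) → ℝ}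
    (hφ : ContDiff ℝ 1 φ) (hc : HasCompactSupport φ) :
    ∃ u : Tilde p Ω, Represents (restrictClosure Ω hφ.continuous hc) u := by
  obtain ⟨w, hw⟩ := exists_sobolev_agreesOn_of_contDiff (p := p) (Ω := Ω) hφ hc
  obtain ⟨u, hu, -⟩ := AgreesOn.exists_represents (v := restrictClosure Ω hφ.continuous hc) hw
  exact ⟨u, hu⟩

theorem exists_contDiff_indicator_le_le_indicator {E : Type*} [NormedAddCommGroup E]
    [NormedSpace ℝ E] [FiniteDimensional ℝ E] {K V : Set E} (hK : IsCompact K) (hV : IsOpen V)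
    (hKV : K ⊆ V) : ∃ φ : E → ℝ, ContDiff ℝ ∞ φ ∧ HasCompactSupport φ ∧
      K.indicator 1 ≤ φ ∧ φ ≤ V.indicator 1 := by
  obtain ⟨R, hR⟩ := hK.isBounded.subset_ball 0
  obtain ⟨φ, hφV, hφK, hφ⟩ := exists_contMDiffMap_zero_one_of_isClosed (n := ⊤)
    (modelWithCornersSelf ℝ E) (hV.inter Metric.isOpen_ball).isClosed_compl hK.isClosed
    (Set.disjoint_compl_left_iff_subset.2 (Set.subset_inter hKV hR))
  refine ⟨φ, φ.contMDiff.contDiff, HasCompactSupport.intro (isCompact_closedBall 0 R) fun x hx =>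
    hφV fun h => hx (Metric.ball_subset_closedBall h.2), ?_, ?_⟩
  · exact Set.indicator_le' (fun x hx => (hφK hx).ge) fun x _ => (hφ x).1
  · exact Set.le_indicator (fun x _ => (hφ x).2) fun x hx => (hφV fun h => hx h.1).le

theorem exists_represents_indicator_le_le_indicator (p : ℝ≥0∞) [Fact (1 ≤ p)]
    {K V : Set (closure Ω)} (hK : IsCompact K) (hV : IsOpen V) (hKV : K ⊆ V) :
    ∃ (χ : C_c(closure Ω, ℝ)) (u : Tilde p Ω),
      Represents χ u ∧ K.indicator 1 ≤ ⇑χ ∧ ⇑χ ≤ V.indicator 1 := by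
  obtain ⟨V, hVopen, rfl⟩ := isOpen_induced_iff.1 hV
  obtain ⟨φ, hφ, hc, hKφ, hφV⟩ := exists_contDiff_indicator_le_le_indicator
    (hK.image continuous_subtype_val) hVopen (Set.image_subset_iff.2 hKV)
  obtain ⟨u, hu⟩ := exists_represents_restrictClosure (p := p) (Ω := Ω) (hφ.of_le (by simp)) hc
  refine ⟨_, u, hu, fun x => le_trans ?_ (hKφ x), fun x => hφV x⟩
  exact (Set.indicator_image Subtype.val_injective (f := 1)).ge

theorem exists_cutoff (p : ℝ≥0∞) [Fact (1 ≤ p)]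
    (v : C_c(closure Ω, ℝ)) :
    ∃ (χ : C_c(closure Ω, ℝ)) (u : Tilde p Ω),
      Represents χ u ∧ (∀ x, 0 ≤ χ x) ∧ ∀ x, v x ≠ 0 → χ x = 1 := by
  obtain ⟨χ, u, hu, hχ, hχ1⟩ := exists_represents_indicator_le_le_indicator p
    v.hasCompactSupport isOpen_univ (Set.subset_univ _)
  refine ⟨χ, u, hu, fun x => le_trans (Set.indicator_nonneg (fun _ _ => zero_le_one) x) (hχ x),
    fun x hx => le_antisymm ?_ ?_⟩
  · simpa using hχ1 x
  · simpa [subset_tsupport v hx] using hχ x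

section ExtendByZero

variable {v : closure Ω → ℝ}

theorem continuousOn_extend_val (hv : Continuous v) :
    ContinuousOn (Function.extend Subtype.val v 0) (closure Ω) := by
  rw [continuousOn_iff_continuous_domRestrict]
  exact hv.congr fun x => (Subtype.val_injective.extend_apply v 0 x).symm

theorem AgreesOn.extend_ae_eq (hΩ : IsOpen Ω) {w : Sobolev p Ω} (h : AgreesOn v w) :
    Function.extend Subtype.val v 0 =ᵐ[volume.restrict Ω] w.1 none := by
  filter_upwards [h, ae_restrict_mem hΩ.measurableSet] with x hx hxΩ
  rw [← hx (subset_closure hxΩ)]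
  exact Subtype.val_injective.extend_apply v 0 ⟨x, subset_closure hxΩ⟩

theorem abs_extend_val_le {B : ℝ} (hB0 : 0 ≤ B) (hB : ∀ x, |v x| ≤ B)
    (x : EuclideanSpace ℝ (Fin N)) : |Function.extend Subtype.val v 0 x| ≤ B := by
  by_cases hx : x ∈ closure Ω
  · exact (congrArg abs (Subtype.val_injective.extend_apply v 0 ⟨x, hx⟩)).trans_le (hB _)
  · rw [Function.extend_apply' _ _ _ (by simpa using hx), Pi.zero_apply, abs_zero]
    exact hB0

theorem integrable_extend_val (hv : Continuous v) (hc : HasCompactSupport v) :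
    Integrable (Function.extend Subtype.val v 0) := by
  obtain ⟨C, hC⟩ := hv.bounded_above_of_compact_support hc
  have hK : IsCompact (Subtype.val '' tsupport v) := hc.isCompact.image continuous_subtype_val
  have hsupp : Function.support (Function.extend Subtype.val v 0) ⊆ Subtype.val '' tsupport v := by
    intro x hx
    have hxΩ : x ∈ closure Ω := by
      by_contra hxΩ
      exact hx (Function.extend_apply' _ _ _ (by simpa using hxΩ))
    exact ⟨⟨x, hxΩ⟩, subset_tsupport v
      (by rwa [Function.mem_support, ← Subtype.val_injective.extend_apply v 0 ⟨x, hxΩ⟩]), rfl⟩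
  have hmeas : Measurable (Function.extend Subtype.val v 0) :=
    (MeasurableEmbedding.subtype_coe isClosed_closure.measurableSet).measurable_extend
      hv.measurable measurable_zero
  rw [← integrableOn_iff_integrable_of_support_subset hsupp]
  exact Measure.integrableOn_of_bounded hK.measure_lt_top.ne hmeas.aestronglyMeasurable
    (Eventually.of_forall (abs_extend_val_le (le_max_right C 0)
      fun x => (hC x).trans (le_max_left _ _)))

end ExtendByZero

theorem AgreesOn.isWeakPartial_comp (hΩ : IsOpen Ω)
    {v : C_c(closure Ω, ℝ)} {w : Sobolev p Ω} (h : AgreesOn v w)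
    {H : ℝ → ℝ} (hH : ContDiff ℝ ∞ H) (i : Fin N) :
    IsWeakPartial Ω i (fun x => H (w.1 none x)) fun x => deriv H (w.1 none x) * w.1 (some i) x := by
  obtain ⟨C, hC⟩ := v.continuous.bounded_above_of_compact_support v.hasCompactSupport
  have hae := h.extend_ae_eq hΩ
  refine IsWeakPartial.congr_ae (IsWeakPartial.comp (B := max C 0) hΩ
    (integrable_extend_val v.continuous v.hasCompactSupport)
    ((continuousOn_extend_val v.continuous).mono subset_closure)
    (abs_extend_val_le (le_max_right _ _) fun x => (hC x).trans (le_max_left _ _))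
    ((Lp.memLp (w.1 (some i))).locallyIntegrable Fact.out)
    ((w.2 i).congr_ae hae.symm (ae_eq_refl _)) hH) (hae.fun_comp H)
    ((hae.fun_comp (deriv H)).mul (ae_eq_refl _))

theorem norm_le_norm_of_forall_norm_apply_le {ι : Type*} [Fintype ι] {β : ι → Type*}
    [∀ i, NormedAddCommGroup (β i)] (hp : p < ⊤) {a b : PiLp p β} (h : ∀ j, ‖a j‖ ≤ ‖b j‖) :
    ‖a‖ ≤ ‖b‖ := by
  have hp0 : 0 < p.toReal := ENNReal.toReal_pos
    (zero_lt_one.trans_le (Fact.out : (1 : ℝ≥0∞) ≤ p)).ne' hp.ne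
  rw [PiLp.norm_eq_sum hp0, PiLp.norm_eq_sum hp0]
  gcongr with j
  exact h j

theorem AgreesOn.exists_sobolev_comp (hp : p < ⊤) (hΩ : IsOpen Ω)
    {v : C_c(closure Ω, ℝ)} {w : Sobolev p Ω} (h : AgreesOn v w)
    {H : ℝ → ℝ} (hH : ContDiff ℝ ∞ H) (hL : LipschitzWith 1 H) (hH0 : H 0 = 0) :
    ∃ w' : Sobolev p Ω, AgreesOn (fun x => H (v x)) w' ∧ ‖w'‖ ≤ ‖w‖ := by
  have hle : ∀ (j : Option (Fin N)) (x : EuclideanSpace ℝ (Fin N)),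
      ‖(j.elim (H (w.1 none x)) fun i => deriv H (w.1 none x) * w.1 (some i) x : ℝ)‖
        ≤ ‖w.1 j x‖ := by
    rintro (_ | i) x
    · simpa [hH0] using hL.norm_sub_le (w.1 none x) 0
    · simp only [Option.elim_some, norm_mul]
      exact mul_le_of_le_one_left (norm_nonneg _) (norm_deriv_le_of_lipschitz hL)
  obtain ⟨w', hw'⟩ := exists_sobolev_ae_eq (p := p) (Ω := Ω)
    (F := fun j x => j.elim (H (w.1 none x)) fun i => deriv H (w.1 none x) * w.1 (some i) x)
    (by
      refine fun j => (Lp.memLp (w.1 j)).of_le ?_ (Eventually.of_forall (hle j))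
      rcases j with _ | i
      · exact hH.continuous.comp_aestronglyMeasurable (Lp.aestronglyMeasurable _)
      · exact ((hH.continuous_deriv (by simp)).comp_aestronglyMeasurable
          (Lp.aestronglyMeasurable _)).mul (Lp.aestronglyMeasurable _))
    fun i => h.isWeakPartial_comp hΩ hH i
  refine ⟨w', ?_, norm_le_norm_of_forall_norm_apply_le hp fun j => Lp.norm_le_norm_of_ae_le ?_⟩
  · filter_upwards [h, hw' none] with x hx hx' hxc
    rw [hx', hx hxc, Option.elim_none]
  · filter_upwards [hw' j] with x hx
    exact (congrArg norm hx).trans_le (hle j x)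

theorem Represents.exists_comp (hp : p < ⊤) (hΩ : IsOpen Ω)
    {v : C_c(closure Ω, ℝ)} {u : Tilde p Ω} (h : Represents v u)
    {H : ℝ → ℝ} (hH : ContDiff ℝ ∞ H) (hL : LipschitzWith 1 H) (hH0 : H 0 = 0) :
    ∃ z : Tilde p Ω, Represents (fun x => H (v x)) z ∧ ‖z‖ ≤ ‖u‖ := by
  obtain ⟨w, hw, hwu⟩ := AgreesOn.exists_sobolev_comp (w := u.1) hp hΩ h hH hL hH0
  let Hv : C_c(closure Ω, ℝ) :=
    ⟨⟨fun x => H (v x), hH.continuous.comp v.continuous⟩, v.hasCompactSupport.comp_left hH0⟩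
  obtain ⟨z, hz, hzw⟩ := AgreesOn.exists_represents (v := Hv) hw
  exact ⟨z, hz, hzw.trans_le hwu⟩

/-- A smooth approximation of `|t|`. The shift by `ε` makes it vanish at `0`, so that composition
with it preserves compact supports. -/
noncomputable def smoothAbs (ε t : ℝ) : ℝ := √(t ^ 2 + ε ^ 2) - ε

section SmoothAbs

variable {ε : ℝ} (hε : 0 < ε)
include hε

theorem contDiff_smoothAbs : ContDiff ℝ ∞ (smoothAbs ε) :=
  (((contDiff_id.pow 2).add contDiff_const).sqrt fun t => by positivity).sub contDiff_const

theorem smoothAbs_zero : smoothAbs ε 0 = 0 := by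
  simp [smoothAbs, Real.sqrt_sq hε.le]

theorem lipschitzWith_smoothAbs : LipschitzWith 1 (smoothAbs ε) := by
  refine lipschitzWith_of_nnnorm_deriv_le ((contDiff_smoothAbs hε).differentiable (by simp))
    fun t => ?_
  have hpos : 0 < t ^ 2 + ε ^ 2 := by positivity
  have hderiv := (((hasDerivAt_pow 2 t).add_const (ε ^ 2)).sqrt hpos.ne').sub_const ε
  have hle : |t| ≤ √(t ^ 2 + ε ^ 2) := Real.abs_le_sqrt (by nlinarith)
  rw [← NNReal.coe_le_coe, coe_nnnorm, show deriv (smoothAbs ε) t = _ from hderiv.deriv,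
    Real.norm_eq_abs, abs_div, abs_of_pos (by positivity : 0 < 2 * √(t ^ 2 + ε ^ 2)),
    NNReal.coe_one, div_le_one (by positivity)]
  simpa [abs_mul] using hle

theorem abs_abs_sub_smoothAbs_le (t : ℝ) : |(|t| - smoothAbs ε t)| ≤ ε := by
  have hlower : |t| ≤ √(t ^ 2 + ε ^ 2) := Real.abs_le_sqrt (by nlinarith)
  have hupper : √(t ^ 2 + ε ^ 2) ≤ |t| + ε :=
    Real.sqrt_le_iff.2 ⟨by positivity, by nlinarith [sq_abs t, abs_nonneg t]⟩
  rw [smoothAbs, abs_le]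
  constructor <;> linarith

end SmoothAbs

open Tilde in
theorem Represents.exists_norm_toLp_sub_abs_le (hp : p < ⊤) (hΩ : IsOpen Ω)
    {v : C_c(closure Ω, ℝ)} {u : Tilde p Ω} (h : Represents v u) {δ : ℝ} (hδ : 0 < δ) :
    ∃ z : Tilde p Ω, ‖z‖ ≤ ‖u‖ ∧ ‖toLp p Ω z - |toLp p Ω u|‖ ≤ δ := by
  obtain ⟨χ, w, hχw, -, hχ⟩ := exists_cutoff p v
  obtain ⟨ε, hε, hεw⟩ := exists_pos_mul_lt hδ ‖toLp p Ω w‖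
  obtain ⟨z, hz, hzu⟩ := h.exists_comp hp hΩ (contDiff_smoothAbs hε)
    (lipschitzWith_smoothAbs hε) (smoothAbs_zero hε)
  refine ⟨z, hzu, (Lp.norm_le_mul_norm_of_ae_le_mul (c := ε) (g := toLp p Ω w) ?_).trans
    ((mul_comm _ _).trans_le hεw.le)⟩
  filter_upwards [hz, h, hχw, Lp.coeFn_sub (toLp p Ω z) |toLp p Ω u|,
    Lp.coeFn_abs (toLp p Ω u), ae_restrict_mem hΩ.measurableSet]
    with x hzx hux hwx hsub habs hxΩ
  have hx := subset_closure hxΩ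
  rw [hsub, Pi.sub_apply, habs, ← hzx hx, ← hux hx, ← hwx hx]
  by_cases hv : v ⟨x, hx⟩ = 0
  · rw [hv, smoothAbs_zero hε, abs_zero, sub_zero, norm_zero]
    positivity
  · rw [hχ _ hv, norm_one, mul_one, norm_sub_rev]
    exact abs_abs_sub_smoothAbs_le hε _

namespace Tilde

theorem exists_represents_norm_sub_lt (u : Tilde p Ω) {ε : ℝ} (hε : 0 < ε) :
    ∃ (v : C_c(closure Ω, ℝ)) (w : Tilde p Ω), Represents v w ∧ ‖w - u‖ < ε := by
  have hu : u.1 ∈ closure (ccSobolev p Ω : Set (Sobolev p Ω)) := u.2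
  obtain ⟨w, ⟨v, hv⟩, hwu⟩ := Metric.mem_closure_iff.1 hu ε hε
  rw [dist_comm, dist_eq_norm] at hwu
  exact ⟨v, ⟨w, (ccSobolev p Ω).le_topologicalClosure ⟨v, hv⟩⟩, hv, hwu⟩

theorem exists_norm_toLp_sub_abs_lt (hp : p < ⊤) (hΩ : IsOpen Ω) (u : Tilde p Ω) {δ : ℝ}
    (hδ : 0 < δ) :
    ∃ z : Tilde p Ω, ‖z‖ ≤ ‖u‖ + δ ∧ ‖toLp p Ω z - |toLp p Ω u|‖ < δ := by
  obtain ⟨v, w, hv, hwu⟩ := exists_represents_norm_sub_lt u (half_pos hδ)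
  obtain ⟨z, hzw, hz⟩ := hv.exists_norm_toLp_sub_abs_le hp hΩ (half_pos hδ)
  refine ⟨z, ?_, ?_⟩
  · linarith [norm_sub_norm_le w u]
  · have hwu' : ‖|toLp p Ω w| - |toLp p Ω u|‖ ≤ ‖w - u‖ :=
      (norm_abs_sub_abs _ _).trans (by simpa only [map_sub] using norm_toLp_le (w - u))
    linarith [norm_sub_le_norm_sub_add_norm_sub (toLp p Ω z) |toLp p Ω w| |toLp p Ω u|]

-- By uniform convexity, images of closed balls under `toLp` are closed, so that the norm bound
-- survives although the approximations of `|u|` only converge in `L^p`.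
theorem exists_toLp_eq_abs (hp1 : 1 < p) (hp : p < ⊤) (hΩ : IsOpen Ω) (u : Tilde p Ω) :
    ∃ z : Tilde p Ω, toLp p Ω z = |toLp p Ω u| ∧ ‖z‖ ≤ ‖u‖ := by
  have := uniformConvexSpace (Ω := Ω) hp1 hp
  have hmem : ∀ δ > 0, ∃ z ∈ Metric.closedBall (0 : Tilde p Ω) (‖u‖ + δ),
      toLp p Ω z = |toLp p Ω u| := fun δ hδ => by
    refine (isClosed_image_closedBall (toLp p Ω) (‖u‖ + δ)).closure_subset
      (Metric.mem_closure_iff.2 fun ε hε => ?_)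
    obtain ⟨z, hzu, hz⟩ := exists_norm_toLp_sub_abs_lt hp hΩ u (lt_min hδ hε)
    refine ⟨_, ⟨z, ?_, rfl⟩, ?_⟩
    · rw [mem_closedBall_zero_iff]
      exact hzu.trans (by gcongr; exact min_le_left δ ε)
    · rw [dist_comm, dist_eq_norm]
      exact hz.trans_le (min_le_right δ ε)
  obtain ⟨z, -, hz⟩ := hmem 1 one_pos
  refine ⟨z, hz, le_of_forall_pos_le_add fun δ hδ => ?_⟩
  obtain ⟨z', hz'δ, hz'⟩ := hmem δ hδ
  rwa [toLp_injective hΩ (hz'.trans hz.symm), mem_closedBall_zero_iff] at hz'δ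

end Tilde

end Truncation

section Capacity

open Tilde

variable {N : ℕ} {p : ℝ≥0∞} [Fact (1 ≤ p)] {Ω : Set (EuclideanSpace ℝ (Fin N))}

theorem relCap_mono {A B : Set (closure Ω)} (h : A ⊆ B) : relCap p Ω A ≤ relCap p Ω B :=
  biInf_mono fun _ ⟨O, hO, hBO, hu⟩ => ⟨O, hO, h.trans hBO, hu⟩

/-- `u` is at least `1` almost everywhere on the trace in `Ω` of the set `O`. -/
def GeOneOn (u : Tilde p Ω) (O : Set (closure Ω)) : Prop :=
  ∀ᵐ x ∂(volume.restrict Ω), x ∈ Subtype.val '' O → 1 ≤ toLp p Ω u x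

theorem GeOneOn.mono {u v : Tilde p Ω} {O : Set (closure Ω)} (hu : GeOneOn u O)
    (huv : toLp p Ω u ≤ toLp p Ω v) : GeOneOn v O := by
  filter_upwards [hu, (Lp.coeFn_le _ _).2 huv] with x hux hx hxO
  exact (hux hxO).trans hx

theorem GeOneOn.iUnion {ι : Type*} [Countable ι] {u : Tilde p Ω} {O : ι → Set (closure Ω)}
    (hu : ∀ i, GeOneOn u (O i)) : GeOneOn u (⋃ i, O i) := by
  filter_upwards [ae_all_iff.2 hu] with x hux hx
  rw [Set.image_iUnion, Set.mem_iUnion] at hx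
  obtain ⟨i, hi⟩ := hx
  exact hux i hi

theorem GeOneOn.union {u : Tilde p Ω} {O O' : Set (closure Ω)} (hO : GeOneOn u O)
    (hO' : GeOneOn u O') : GeOneOn u (O ∪ O') := by
  filter_upwards [hO, hO'] with x hxO hxO' hx
  rw [Set.image_union] at hx
  exact hx.elim hxO hxO'

theorem relCap_le_of_geOneOn {A O : Set (closure Ω)} (hO : IsOpen O) (hAO : A ⊆ O)
    {u : Tilde p Ω} (hu : GeOneOn u O) : relCap p Ω A ≤ ENNReal.ofReal (‖u‖ ^ p.toReal) :=
  iInf₂_le (f := fun (w : TildeSobolev p Ω) (_ : w ∈ admissible p Ω A) =>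
    ENNReal.ofReal (‖w‖ ^ p.toReal)) u ⟨O, hO, hAO, hu⟩

theorem le_relCap {A : Set (closure Ω)} {c : ℝ≥0∞}
    (h : ∀ (u : Tilde p Ω) (O : Set (closure Ω)), IsOpen O → A ⊆ O → GeOneOn u O →
      c ≤ ENNReal.ofReal (‖u‖ ^ p.toReal)) : c ≤ relCap p Ω A :=
  le_iInf₂ fun u ⟨O, hO, hAO, hu⟩ => h u O hO hAO hu

/-- `A` has a nonnegative competitor for the capacity of norm at most `r`. Phrasing
smallness of the capacity by norms of nonnegative functions makes the bounds add under unions. -/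
def HasCompetitor (p : ℝ≥0∞) [Fact (1 ≤ p)] (A : Set (closure Ω)) (r : ℝ) : Prop :=
  ∃ (u : Tilde p Ω) (O : Set (closure Ω)), IsOpen O ∧ A ⊆ O ∧ 0 ≤ toLp p Ω u ∧ GeOneOn u O ∧
    ‖u‖ ≤ r

theorem HasCompetitor.mono {A B : Set (closure Ω)} {r s : ℝ} (h : HasCompetitor p B r)
    (hAB : A ⊆ B) (hrs : r ≤ s) : HasCompetitor p A s := by
  obtain ⟨u, O, hO, hBO, hu0, hu1, hur⟩ := h
  exact ⟨u, O, hO, hAB.trans hBO, hu0, hu1, hur.trans hrs⟩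

theorem HasCompetitor.union {A B : Set (closure Ω)} {r s : ℝ} (hA : HasCompetitor p A r)
    (hB : HasCompetitor p B s) : HasCompetitor p (A ∪ B) (r + s) := by
  obtain ⟨u, O, hO, hAO, hu0, hu1, hur⟩ := hA
  obtain ⟨v, O', hO', hBO', hv0, hv1, hvs⟩ := hB
  refine ⟨u + v, O ∪ O', hO.union hO', Set.union_subset_union hAO hBO', ?_, ?_,
    (norm_add_le _ _).trans (add_le_add hur hvs)⟩
  · rw [map_add]
    exact add_nonneg hu0 hv0
  · refine (hu1.mono ?_).union (hv1.mono ?_) <;> rw [map_add]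
    · exact le_add_of_nonneg_right hv0
    · exact le_add_of_nonneg_left hu0

theorem HasCompetitor.iUnion {A : ℕ → Set (closure Ω)} {r : ℕ → ℝ}
    (h : ∀ n, HasCompetitor p (A n) (r n)) (hr : Summable r) :
    HasCompetitor p (⋃ n, A n) (∑' n, r n) := by
  choose u O hO hAO hu0 hu1 hur using h
  have hnorm : Summable fun n => ‖u n‖ := hr.of_nonneg_of_le (fun _ => norm_nonneg _) hur
  have hsum : HasSum (fun n => toLp p Ω (u n)) (toLp p Ω (∑' n, u n)) :=
    (toLp p Ω).hasSum hnorm.of_norm.hasSum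
  have hle : ∀ n, toLp p Ω (u n) ≤ toLp p Ω (∑' n, u n) := fun n =>
    le_hasSum hsum n fun m _ => hu0 m
  exact ⟨∑' n, u n, ⋃ n, O n, isOpen_iUnion hO, Set.iUnion_mono hAO, (hu0 0).trans (hle 0),
    GeOneOn.iUnion fun n => (hu1 n).mono (hle n),
    (norm_tsum_le_tsum_norm hnorm).trans (hnorm.tsum_le_tsum hur hr)⟩

theorem HasCompetitor.relCap_le {A : Set (closure Ω)} {r : ℝ} (h : HasCompetitor p A r) :
    relCap p Ω A ≤ ENNReal.ofReal (r ^ p.toReal) := by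
  obtain ⟨u, O, hO, hAO, -, hu, hur⟩ := h
  refine (relCap_le_of_geOneOn hO hAO hu).trans ?_
  gcongr

theorem GeOneOn.exists_nonneg (hp1 : 1 < p) (hp : p < ⊤) (hΩ : IsOpen Ω) {u : Tilde p Ω}
    {O : Set (closure Ω)} (hu : GeOneOn u O) :
    ∃ z : Tilde p Ω, 0 ≤ toLp p Ω z ∧ GeOneOn z O ∧ ‖z‖ ≤ ‖u‖ := by
  obtain ⟨z, hz, hzu⟩ := exists_toLp_eq_abs hp1 hp hΩ u
  exact ⟨z, hz ▸ abs_nonneg _, hu.mono (hz ▸ le_abs_self _), hzu⟩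

theorem hasCompetitor_of_relCap_lt (hp1 : 1 < p) (hp : p < ⊤) (hΩ : IsOpen Ω)
    {A : Set (closure Ω)} {r : ℝ} (hr : 0 ≤ r)
    (h : relCap p Ω A < ENNReal.ofReal (r ^ p.toReal)) : HasCompetitor p A r := by
  contrapose! h
  refine le_relCap fun u O hO hAO hu => ?_
  obtain ⟨z, hz0, hz1, hzu⟩ := hu.exists_nonneg hp1 hp hΩ
  have hru : r ≤ ‖u‖ := le_of_not_ge fun hur => h ⟨z, O, hO, hAO, hz0, hz1, hzu.trans hur⟩
  gcongr

theorem exists_pos_ofReal_rpow_lt {q : ℝ} (hq : 0 < q) {ε : ℝ≥0∞} (hε : 0 < ε) :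
    ∃ t > 0, ENNReal.ofReal (t ^ q) < ε := by
  have hlim : Tendsto (fun t : ℝ => ENNReal.ofReal (t ^ q)) (𝓝[>] 0) (𝓝 0) := by
    have h := (ENNReal.continuous_ofReal.comp (Real.continuous_rpow_const hq.le)).tendsto 0
    simp only [Function.comp_apply, Real.zero_rpow hq.ne', ENNReal.ofReal_zero] at h
    exact h.mono_left nhdsWithin_le_nhds
  obtain ⟨t, ht, ht0⟩ := ((hlim.eventually (gt_mem_nhds hε)).and self_mem_nhdsWithin).exists
  exact ⟨t, ht0, ht⟩

theorem relCap_eq_zero_iff (hp1 : 1 < p) (hp : p < ⊤) (hΩ : IsOpen Ω) {A : Set (closure Ω)} :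
    relCap p Ω A = 0 ↔ ∀ ε : ℝ, 0 < ε → HasCompetitor p A ε := by
  refine ⟨fun h ε hε => hasCompetitor_of_relCap_lt hp1 hp hΩ hε.le ?_, fun h => ?_⟩
  · rw [h]
    exact ENNReal.ofReal_pos.2 (Real.rpow_pos_of_pos hε _)
  · by_contra hne
    obtain ⟨t, ht, hlt⟩ := exists_pos_ofReal_rpow_lt
      (zero_lt_one.trans (one_lt_toReal hp1 hp)) (pos_iff_ne_zero.2 hne)
    exact ((h t ht).relCap_le.trans_lt hlt).false

/-- The property `P` holds quasi everywhere on `closure Ω`. -/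
def QuasiEverywhere (p : ℝ≥0∞) [Fact (1 ≤ p)] (P : closure Ω → Prop) : Prop :=
  relCap p Ω {x | ¬ P x} = 0

theorem QuasiEverywhere.mono {P Q : closure Ω → Prop} (h : QuasiEverywhere p P)
    (hPQ : ∀ x, P x → Q x) : QuasiEverywhere p Q :=
  le_antisymm ((relCap_mono (A := {x | ¬ Q x}) fun x hx hPx => hx (hPQ x hPx)).trans_eq h) bot_le

theorem quasiEverywhere_iff_exists {P : closure Ω → Prop} :
    QuasiEverywhere p P ↔ ∃ E : Set (closure Ω), relCap p Ω E = 0 ∧ ∀ x ∉ E, P x :=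
  ⟨fun h => ⟨_, h, fun _ hx => not_not.1 hx⟩, fun ⟨E, hE, h⟩ =>
    QuasiEverywhere.mono (P := (· ∉ E)) (by simpa [QuasiEverywhere] using hE) h⟩

theorem QuasiEverywhere.and (hp1 : 1 < p) (hp : p < ⊤) (hΩ : IsOpen Ω) {P Q : closure Ω → Prop}
    (hP : QuasiEverywhere p P) (hQ : QuasiEverywhere p Q) :
    QuasiEverywhere p fun x => P x ∧ Q x := by
  rw [QuasiEverywhere, relCap_eq_zero_iff hp1 hp hΩ] at hP hQ ⊢
  refine fun ε hε => ((hP _ (half_pos hε)).union (hQ _ (half_pos hε))).mono ?_ (add_halves ε).le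
  exact fun x => not_and_or.1

theorem quasiEverywhere_all_nat (hp1 : 1 < p) (hp : p < ⊤) (hΩ : IsOpen Ω)
    {P : ℕ → closure Ω → Prop} (hP : ∀ n, QuasiEverywhere p (P n)) :
    QuasiEverywhere p fun x => ∀ n, P n x := by
  simp only [QuasiEverywhere, relCap_eq_zero_iff hp1 hp hΩ] at hP ⊢
  intro ε hε
  have hsum : HasSum (fun n : ℕ => ε / 2 / 2 ^ n) ε := hasSum_geometric_two' ε
  refine (HasCompetitor.iUnion (fun n => hP n (ε / 2 / 2 ^ n) (by positivity))
    hsum.summable).mono (fun x hx => Set.mem_iUnion.2 (not_forall.1 hx)) hsum.tsum_eq.le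

theorem quasiContinuous_iff (hp1 : 1 < p) (hp : p < ⊤) (hΩ : IsOpen Ω) {f : closure Ω → ℝ} :
    QuasiContinuous p Ω f ↔ ∀ ε : ℝ, 0 < ε →
      ∃ V : Set (closure Ω), IsOpen V ∧ HasCompetitor p V ε ∧ ContinuousOn f Vᶜ := by
  refine ⟨fun h ε hε => ?_, fun h ε hε => ?_⟩
  · obtain ⟨V, hVo, hV, hf⟩ := h (ENNReal.ofReal (ε ^ p.toReal))
      (ENNReal.ofReal_pos.2 (Real.rpow_pos_of_pos hε _))
    exact ⟨V, hVo, hasCompetitor_of_relCap_lt hp1 hp hΩ hε.le hV, hf⟩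
  · obtain ⟨t, ht, htε⟩ := exists_pos_ofReal_rpow_lt
      (zero_lt_one.trans (one_lt_toReal hp1 hp)) hε
    obtain ⟨V, hVo, hV, hf⟩ := h t ht
    exact ⟨V, hVo, hV.relCap_le.trans_lt htε, hf⟩

theorem quasiContinuous_of_continuous (hp : p < ⊤) {f : closure Ω → ℝ} (hf : Continuous f) :
    QuasiContinuous p Ω f :=
  fun ε hε => ⟨∅, isOpen_empty, by rwa [relCap_empty hp], hf.continuousOn⟩

theorem QuasiContinuous.add (hp1 : 1 < p) (hp : p < ⊤) (hΩ : IsOpen Ω) {f g : closure Ω → ℝ}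
    (hf : QuasiContinuous p Ω f) (hg : QuasiContinuous p Ω g) : QuasiContinuous p Ω (f + g) := by
  rw [quasiContinuous_iff hp1 hp hΩ] at hf hg ⊢
  intro ε hε
  obtain ⟨V, hVo, hV, hfV⟩ := hf (ε / 2) (half_pos hε)
  obtain ⟨W, hWo, hW, hgW⟩ := hg (ε / 2) (half_pos hε)
  refine ⟨V ∪ W, hVo.union hWo, add_halves ε ▸ hV.union hW, ?_⟩
  rw [Set.compl_union]
  exact (hfV.mono Set.inter_subset_left).add (hgW.mono Set.inter_subset_right)

theorem QuasiContinuous.smul (c : ℝ) {f : closure Ω → ℝ} (hf : QuasiContinuous p Ω f) :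
    QuasiContinuous p Ω (c • f) := fun ε hε => by
  obtain ⟨V, hVo, hV, hfV⟩ := hf ε hε
  exact ⟨V, hVo, hV, hfV.const_smul c⟩

theorem QuasiContinuous.sub (hp1 : 1 < p) (hp : p < ⊤) (hΩ : IsOpen Ω) {f g : closure Ω → ℝ}
    (hf : QuasiContinuous p Ω f) (hg : QuasiContinuous p Ω g) : QuasiContinuous p Ω (f - g) := by
  have := hf.add hp1 hp hΩ (hg.smul (-1))
  rwa [neg_one_smul, ← sub_eq_add_neg] at this

theorem QuasiContinuous.exists_isOpen_mem_iff (hp1 : 1 < p) (hp : p < ⊤) (hΩ : IsOpen Ω)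
    {f : closure Ω → ℝ} (hf : QuasiContinuous p Ω f) {T : Set ℝ} (hT : IsOpen T) {ε : ℝ}
    (hε : 0 < ε) :
    ∃ V W : Set (closure Ω), IsOpen V ∧ IsOpen W ∧ HasCompetitor p V ε ∧
      ∀ x ∉ V, x ∈ W ↔ f x ∈ T := by
  obtain ⟨V, hVo, hV, hfV⟩ := (quasiContinuous_iff hp1 hp hΩ).1 hf ε hε
  obtain ⟨W, hWo, hW⟩ := continuousOn_iff'.1 hfV T hT
  refine ⟨V, W, hVo, hWo, hV, fun x hx => ?_⟩
  simpa [hx] using (Set.ext_iff.1 hW x).symm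

theorem QuasiContinuous.hasCompetitor_one_lt (hp1 : 1 < p) (hp : p < ⊤) (hΩ : IsOpen Ω)
    {f : closure Ω → ℝ} {u : Tilde p Ω} (hf : QuasiContinuous p Ω f) (hfu : Represents f u)
    {ε : ℝ} (hε : 0 < ε) : HasCompetitor p {x | 1 < f x} (‖u‖ + ε) := by
  obtain ⟨V, W, -, hWo, ⟨w, O, hO, hVO, hw0, hw1, hwε⟩, hW⟩ :=
    hf.exists_isOpen_mem_iff hp1 hp hΩ isOpen_Ioi hε
  obtain ⟨z, hz, hzu⟩ := exists_toLp_eq_abs hp1 hp hΩ u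
  have hz0 : 0 ≤ toLp p Ω z := hz ▸ abs_nonneg _
  have hwz : toLp p Ω w ≤ toLp p Ω (z + w) := by
    rw [map_add]
    exact le_add_of_nonneg_left hz0
  refine ⟨z + w, W ∪ O, hWo.union hO, fun x hx => ?_, hw0.trans hwz, ?_,
    (norm_add_le _ _).trans (add_le_add hzu hwε)⟩
  · by_cases hxV : x ∈ V
    exacts [Or.inr (hVO hxV), Or.inl ((hW x hxV).2 hx)]
  · have huz : toLp p Ω u ≤ toLp p Ω (z + w) := by
      rw [map_add, hz]
      exact (le_abs_self _).trans (le_add_of_nonneg_right hw0)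
    filter_upwards [hfu, (Lp.coeFn_le _ _).2 huz, hw1.mono hwz] with x hfx hux hwx hx
    obtain ⟨y, hy, rfl⟩ := hx
    by_cases hyV : y ∈ V
    · exact hwx ⟨y, hVO hyV, rfl⟩
    · rcases hy with hyW | hyO
      · exact (((hW y hyV).1 hyW).le.trans_eq (hfx y.2)).trans hux
      · exact hwx ⟨y, hyO, rfl⟩

theorem QuasiContinuous.hasCompetitor_lt (hp1 : 1 < p) (hp : p < ⊤) (hΩ : IsOpen Ω)
    {f : closure Ω → ℝ} {u : Tilde p Ω} (hf : QuasiContinuous p Ω f) (hfu : Represents f u)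
    {c r : ℝ} (hc : 0 < c) (hr : ‖u‖ < c * r) : HasCompetitor p {x | c < f x} r := by
  have hnorm : ‖c⁻¹ • u‖ < r := by
    rwa [norm_smul, norm_inv, Real.norm_of_nonneg hc.le, inv_mul_lt_iff₀ hc]
  refine ((hf.smul c⁻¹).hasCompetitor_one_lt hp1 hp hΩ (hfu.smul c⁻¹) (sub_pos.2 hnorm)).mono
    (fun x hx => ?_) (add_sub_cancel _ _).le
  rwa [Set.mem_ofPred_eq, Pi.smul_apply, smul_eq_mul, lt_inv_mul_iff₀ hc, mul_one]

theorem relCap_le_of_quasiEverywhere_one_le (hp1 : 1 < p) (hp : p < ⊤) (hΩ : IsOpen Ω)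
    {f : closure Ω → ℝ} {u : Tilde p Ω} (hf : QuasiContinuous p Ω f) (hfu : Represents f u)
    {A : Set (closure Ω)} (hA : QuasiEverywhere p fun x => x ∈ A → 1 ≤ f x) :
    relCap p Ω A ≤ ENNReal.ofReal (‖u‖ ^ p.toReal) := by
  have hlim : Tendsto (fun δ : ℝ => ENNReal.ofReal (((1 + δ) * ‖u‖ + δ + δ) ^ p.toReal)) (𝓝[>] 0)
      (𝓝 (ENNReal.ofReal (‖u‖ ^ p.toReal))) := by
    have hcont : Continuous fun δ : ℝ => ENNReal.ofReal (((1 + δ) * ‖u‖ + δ + δ) ^ p.toReal) :=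
      ENNReal.continuous_ofReal.comp (Continuous.rpow_const (by fun_prop)
        fun _ => Or.inr ENNReal.toReal_nonneg)
    simpa using (hcont.tendsto 0).mono_left (nhdsWithin_le_nhds (s := Set.Ioi 0))
  refine ge_of_tendsto hlim ?_
  filter_upwards [self_mem_nhdsWithin] with δ (hδ : 0 < δ)
  have hnorm : ‖(1 + δ) • u‖ = (1 + δ) * ‖u‖ := by
    rw [norm_smul, Real.norm_of_nonneg (by positivity)]
  have hstrict := (hf.smul (1 + δ)).hasCompetitor_one_lt hp1 hp hΩ (hfu.smul (1 + δ)) hδ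
  have hexc := (relCap_eq_zero_iff hp1 hp hΩ).1 hA δ hδ
  rw [hnorm] at hstrict
  refine ((hstrict.union hexc).mono (fun x hx => or_iff_not_imp_right.2 fun hfx => ?_)
    le_rfl).relCap_le
  have hfx1 : 1 ≤ f x := not_not.1 hfx hx
  change 1 < (1 + δ) * f x
  nlinarith

theorem GeOneOn.quasiEverywhere_one_le (hp1 : 1 < p) (hp : p < ⊤) (hΩ : IsOpen Ω)
    {f : closure Ω → ℝ} {u : Tilde p Ω} (hf : QuasiContinuous p Ω f) (hfu : Represents f u)
    {O : Set (closure Ω)} (hO : IsOpen O) (hu : GeOneOn u O) :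
    QuasiEverywhere p fun x => x ∈ O → 1 ≤ f x := by
  rw [QuasiEverywhere, relCap_eq_zero_iff hp1 hp hΩ]
  intro ε hε
  obtain ⟨V, W, hVo, hWo, ⟨w, O', -, hVO', hw0, hw1, hwε⟩, hW⟩ :=
    hf.exists_isOpen_mem_iff hp1 hp hΩ (isOpen_Iio (a := 1)) hε
  refine ⟨w, O ∩ (V ∪ W), hO.inter (hVo.union hWo), fun x hx => ?_, hw0, ?_, hwε⟩
  · obtain ⟨hxO, hfx⟩ := Classical.not_imp.1 hx
    by_cases hxV : x ∈ V
    exacts [⟨hxO, Or.inl hxV⟩, ⟨hxO, Or.inr ((hW x hxV).2 (not_le.1 hfx))⟩]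
  · filter_upwards [hw1, hu, hfu] with x hwx hux hfx hx
    obtain ⟨y, ⟨hyO, hy⟩, rfl⟩ := hx
    by_cases hyV : y ∈ V
    · exact hwx ⟨y, hVO' hyV, rfl⟩
    · have hlt : f y < 1 := (hW y hyV).1 (hy.resolve_left hyV)
      exact absurd ((hux ⟨y, hyO, rfl⟩).trans_eq (hfx y.2).symm) hlt.not_ge

end Capacity

section QuasiContinuousVersion

open Tilde

theorem tendstoUniformlyOn_limUnder_of_summable {X E : Type*} [MetricSpace E] [CompleteSpace E]
    [Nonempty E] {v : ℕ → X → E} {s : Set X} {d : ℕ → ℝ} (hd : Summable d)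
    (h : ∀ᶠ n in atTop, ∀ x ∈ s, dist (v n x) (v (n + 1) x) ≤ d n) :
    TendstoUniformlyOn v (fun x => limUnder atTop fun n => v n x) atTop s := by
  obtain ⟨k, hk⟩ := eventually_atTop.1 h
  have hdist : ∀ x ∈ s, ∀ n, dist (v (n + k) x) (v (n + 1 + k) x) ≤ d (n + k) := fun x hx n => by
    simpa only [add_right_comm] using hk (n + k) (Nat.le_add_left k n) x hx
  have hdk : Summable fun n => d (n + k) := (summable_nat_add_iff k).2 hd
  have hlim : ∀ x ∈ s,
      Tendsto (fun n => v (n + k) x) atTop (𝓝 (limUnder atTop fun n => v n x)) := fun x hx => by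
    obtain ⟨l, hl⟩ := cauchySeq_tendsto_of_complete
      (cauchySeq_of_dist_le_of_summable _ (hdist x hx) hdk)
    rw [((tendsto_add_atTop_iff_nat (f := fun n => v n x) k).1 hl).limUnder_eq]
    exact hl
  rw [Metric.tendstoUniformlyOn_iff]
  intro ε hε
  have htail := tendsto_sum_nat_add fun n => d (n + k)
  have hev : ∀ᶠ n in atTop, ∀ x ∈ s, dist (limUnder atTop fun n => v n x) (v (n + k) x) < ε := by
    filter_upwards [htail.eventually (gt_mem_nhds hε)] with n hn x hx
    rw [dist_comm]
    refine (dist_le_tsum_of_dist_le_of_tendsto _ (hdist x hx) hdk (hlim x hx) n).trans_lt ?_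
    simpa only [add_comm] using hn
  obtain ⟨m, hm⟩ := eventually_atTop.1 hev
  filter_upwards [eventually_ge_atTop (m + k)] with n hn x hx
  have := hm (n - k) (by omega) x hx
  rwa [Nat.sub_add_cancel (by omega)] at this

variable {N : ℕ} {p : ℝ≥0∞} [Fact (1 ≤ p)] {Ω : Set (EuclideanSpace ℝ (Fin N))}

theorem QuasiContinuous.hasCompetitor_lt_abs (hp1 : 1 < p) (hp : p < ⊤) (hΩ : IsOpen Ω)
    {f : closure Ω → ℝ} {u : Tilde p Ω} (hf : QuasiContinuous p Ω f) (hfu : Represents f u)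
    {c r : ℝ} (hc : 0 < c) (hr : ‖u‖ < c * r) : HasCompetitor p {x | c < |f x|} (r + r) := by
  refine ((hf.hasCompetitor_lt hp1 hp hΩ hfu hc hr).union
    ((hf.smul (-1)).hasCompetitor_lt hp1 hp hΩ (hfu.smul (-1)) hc ?_)).mono
    (fun x (hx : c < |f x|) => ?_) le_rfl
  · rwa [neg_one_smul, norm_neg]
  · simpa using lt_abs.1 hx

theorem HasCompetitor.exists_iUnion_add {B : ℕ → Set (closure Ω)} {r : ℕ → ℝ}
    (hB : ∀ n, HasCompetitor p (B n) (r n)) (hr : Summable r) {ε : ℝ} (hε : 0 < ε) :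
    ∃ k, HasCompetitor p (⋃ n, B (n + k)) ε := by
  obtain ⟨k, hk⟩ := ((tendsto_sum_nat_add r).eventually (gt_mem_nhds hε)).exists
  exact ⟨k, (HasCompetitor.iUnion (fun n => hB (n + k)) ((summable_nat_add_iff k).2 hr)).mono
    subset_rfl hk.le⟩

theorem quasiContinuous_limUnder_of_summable (hp1 : 1 < p) (hp : p < ⊤) (hΩ : IsOpen Ω)
    {v : ℕ → closure Ω → ℝ} (hv : ∀ n, Continuous (v n)) {d r : ℕ → ℝ} (hd : Summable d)
    (hr : Summable r) (h : ∀ n, HasCompetitor p {x | d n < dist (v n x) (v (n + 1) x)} (r n)) :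
    QuasiContinuous p Ω (fun x => limUnder atTop fun n => v n x) ∧
      QuasiEverywhere p fun x =>
        Tendsto (fun n => v n x) atTop (𝓝 (limUnder atTop fun n => v n x)) := by
  have hunif : ∀ k, TendstoUniformlyOn v (fun x => limUnder atTop fun n => v n x) atTop
      (⋃ n, {x | d (n + k) < dist (v (n + k) x) (v (n + k + 1) x)})ᶜ := fun k => by
    refine tendstoUniformlyOn_limUnder_of_summable hd ?_
    filter_upwards [eventually_ge_atTop k] with n hn x hx
    obtain ⟨m, rfl⟩ := Nat.exists_eq_add_of_le' hn
    exact not_lt.1 fun hlt => hx (Set.mem_iUnion.2 ⟨m, hlt⟩)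
  rw [quasiContinuous_iff hp1 hp hΩ, QuasiEverywhere, relCap_eq_zero_iff hp1 hp hΩ]
  refine ⟨fun ε hε => ?_, fun ε hε => ?_⟩ <;>
    obtain ⟨k, hk⟩ := HasCompetitor.exists_iUnion_add h hr hε
  · exact ⟨_, isOpen_iUnion fun n => isOpen_lt continuous_const ((hv _).dist (hv _)), hk,
      (hunif k).continuousOn (Frequently.of_forall fun n => (hv n).continuousOn)⟩
  · exact hk.mono (fun x hx => by_contra fun hxk => hx ((hunif k).tendsto_at hxk)) le_rfl

theorem Represents.of_tendsto (hp : p < ⊤) {v : ℕ → closure Ω → ℝ} {w : ℕ → Tilde p Ω}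
    {f : closure Ω → ℝ} {u : Tilde p Ω} (hvw : ∀ n, Represents (v n) (w n))
    (hw : Tendsto w atTop (𝓝 u))
    (hv : QuasiEverywhere p fun x => Tendsto (fun n => v n x) atTop (𝓝 (f x))) :
    Represents f u := by
  obtain ⟨ns, hns, hae⟩ := (tendstoInMeasure_of_tendsto_Lp
    (((toLp p Ω).continuous.tendsto u).comp hw)).exists_seq_tendsto_ae
  filter_upwards [hae, ae_all_iff.2 hvw, ae_notMem_of_relCap_eq_zero hp hv] with x hwx hvwx hvx hx
  have hfx : Tendsto (fun n => v n ⟨x, hx⟩) atTop (𝓝 (f ⟨x, hx⟩)) :=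
    by_contra fun hne => hvx ⟨_, hne, rfl⟩
  exact tendsto_nhds_unique (hfx.comp hns.tendsto_atTop) (hwx.congr fun n => (hvwx _ hx).symm)

theorem exists_quasiContinuous_represents (hp1 : 1 < p) (hp : p < ⊤) (hΩ : IsOpen Ω)
    (u : Tilde p Ω) : ∃ f : closure Ω → ℝ, QuasiContinuous p Ω f ∧ Represents f u := by
  choose v w hvw hwu using fun n : ℕ => exists_represents_norm_sub_lt u
    (show (0 : ℝ) < (1 / 2) ^ n * (1 / 2) ^ n / 2 by positivity)
  have hw : ∀ n, ‖w n - w (n + 1)‖ < (1 / 2) ^ n * (1 / 2) ^ n := fun n => by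
    have htri := norm_sub_le_norm_sub_add_norm_sub (w n) u (w (n + 1))
    have hsucc := hwu (n + 1)
    rw [norm_sub_rev, pow_succ] at hsucc
    nlinarith [hwu n, show (0 : ℝ) < (1 / 2) ^ n * (1 / 2) ^ n by positivity]
  have hlim : Tendsto w atTop (𝓝 u) := by
    rw [tendsto_iff_norm_sub_tendsto_zero]
    refine squeeze_zero (fun _ => norm_nonneg _) (fun n => (hwu n).le) ?_
    have hpow : Tendsto (fun n : ℕ => (1 / 2 : ℝ) ^ n) atTop (𝓝 0) :=
      tendsto_pow_atTop_nhds_zero_of_lt_one (by norm_num) (by norm_num)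
    simpa using (hpow.mul hpow).div_const 2
  obtain ⟨hf, hvf⟩ := quasiContinuous_limUnder_of_summable hp1 hp hΩ
    (fun n => (v n).continuous) summable_geometric_two
    (summable_geometric_two.add summable_geometric_two) fun n =>
      QuasiContinuous.hasCompetitor_lt_abs hp1 hp hΩ
        (quasiContinuous_of_continuous hp ((v n).continuous.sub (v (n + 1)).continuous))
        ((hvw n).sub (hvw (n + 1))) (by positivity) (hw n)
  exact ⟨_, hf, Represents.of_tendsto hp hvw hlim hvf⟩

end QuasiContinuousVersion

section Extremal

open Tilde

variable {N : ℕ} {p : ℝ≥0∞} [Fact (1 ≤ p)] {Ω : Set (EuclideanSpace ℝ (Fin N))}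

/-- The elements of `W̃^{1,p}(Ω)` with a quasi continuous version that is at least `1` quasi
everywhere on `A`. In contrast to `admissible p Ω A`, this set is closed. -/
def quasiAdmissible (p : ℝ≥0∞) [Fact (1 ≤ p)] (A : Set (closure Ω)) : Set (Tilde p Ω) :=
  {u | ∃ f : closure Ω → ℝ, QuasiContinuous p Ω f ∧ Represents f u ∧
    QuasiEverywhere p fun x => x ∈ A → 1 ≤ f x}

variable {A : Set (closure Ω)} {u : Tilde p Ω}

theorem relCap_le_of_mem_quasiAdmissible (hp1 : 1 < p) (hp : p < ⊤) (hΩ : IsOpen Ω)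
    (hu : u ∈ quasiAdmissible p A) : relCap p Ω A ≤ ENNReal.ofReal (‖u‖ ^ p.toReal) := by
  obtain ⟨f, hf, hfu, hA⟩ := hu
  exact relCap_le_of_quasiEverywhere_one_le hp1 hp hΩ hf hfu hA

theorem GeOneOn.mem_quasiAdmissible (hp1 : 1 < p) (hp : p < ⊤) (hΩ : IsOpen Ω)
    {O : Set (closure Ω)} (hO : IsOpen O) (hAO : A ⊆ O) (hu : GeOneOn u O) :
    u ∈ quasiAdmissible p A := by
  obtain ⟨f, hf, hfu⟩ := exists_quasiContinuous_represents hp1 hp hΩ u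
  exact ⟨f, hf, hfu, (hu.quasiEverywhere_one_le hp1 hp hΩ hf hfu hO).mono
    fun x hx hxA => hx (hAO hxA)⟩

theorem quasiAdmissible_nonempty (hp1 : 1 < p) (hp : p < ⊤) (hΩ : IsOpen Ω)
    (hA : relCap p Ω A < ⊤) : (quasiAdmissible p A).Nonempty := by
  by_contra hempty
  refine hA.not_ge (le_relCap fun u O hO hAO hu => absurd ?_ hempty)
  exact ⟨u, hu.mem_quasiAdmissible hp1 hp hΩ hO hAO⟩

theorem isMinOn_norm_quasiAdmissible_iff (hp1 : 1 < p) (hp : p < ⊤) (hΩ : IsOpen Ω)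
    (hu : u ∈ quasiAdmissible p A) : IsMinOn norm (quasiAdmissible p A) u ↔
      ENNReal.ofReal (‖u‖ ^ p.toReal) = relCap p Ω A := by
  have hq := zero_lt_one.trans (one_lt_toReal hp1 hp)
  refine ⟨fun h => le_antisymm (le_relCap fun v O hO hAO hv => ?_)
    (relCap_le_of_mem_quasiAdmissible hp1 hp hΩ hu), fun h v hv => ?_⟩
  · have huv : ‖u‖ ≤ ‖v‖ := h (hv.mem_quasiAdmissible hp1 hp hΩ hO hAO)
    gcongr
  · have huv := h.trans_le (relCap_le_of_mem_quasiAdmissible hp1 hp hΩ hv)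
    rwa [ENNReal.ofReal_le_ofReal_iff (by positivity),
      Real.rpow_le_rpow_iff (norm_nonneg u) (norm_nonneg v) hq] at huv

theorem convex_quasiAdmissible (hp1 : 1 < p) (hp : p < ⊤) (hΩ : IsOpen Ω)
    (A : Set (closure Ω)) : Convex ℝ (quasiAdmissible p A) := by
  rintro u ⟨f, hf, hfu, hfA⟩ v ⟨g, hg, hgv, hgA⟩ a b ha hb hab
  refine ⟨a • f + b • g, (hf.smul a).add hp1 hp hΩ (hg.smul b), (hfu.smul a).add (hgv.smul b),
    (hfA.and hp1 hp hΩ hgA).mono fun x hx hxA => ?_⟩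
  calc 1 = a * 1 + b * 1 := by rw [mul_one, mul_one, hab]
    _ ≤ a * f x + b * g x := by
      gcongr
      exacts [hx.1 hxA, hx.2 hxA]

theorem quasiEverywhere_sub_le_of_mem_closure (hp1 : 1 < p) (hp : p < ⊤) (hΩ : IsOpen Ω)
    (hu : u ∈ closure (quasiAdmissible p A)) {f : closure Ω → ℝ} (hf : QuasiContinuous p Ω f)
    (hfu : Represents f u) {c : ℝ} (hc : 0 < c) :
    QuasiEverywhere p fun x => x ∈ A → 1 - c ≤ f x := by
  rw [QuasiEverywhere, relCap_eq_zero_iff hp1 hp hΩ]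
  intro ε hε
  obtain ⟨w, ⟨g, hg, hgw, hgA⟩, hwu⟩ := Metric.mem_closure_iff.1 hu (c * (ε / 2)) (by positivity)
  rw [dist_comm, dist_eq_norm] at hwu
  have hnull := (relCap_eq_zero_iff hp1 hp hΩ).1 hgA (ε / 2) (half_pos hε)
  have hsub := (hg.sub hp1 hp hΩ hf).hasCompetitor_lt hp1 hp hΩ (hgw.sub hfu) hc hwu
  refine (hnull.union hsub).mono (fun x hx => or_iff_not_imp_left.2 fun hgx => ?_)
    (add_halves ε).le
  obtain ⟨hxA, hfx⟩ := Classical.not_imp.1 hx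
  have hgx1 : 1 ≤ g x := not_not.1 hgx hxA
  change c < g x - f x
  linarith

theorem quasiEverywhere_one_le_of_mem_closure (hp1 : 1 < p) (hp : p < ⊤) (hΩ : IsOpen Ω)
    (hu : u ∈ closure (quasiAdmissible p A)) {f : closure Ω → ℝ} (hf : QuasiContinuous p Ω f)
    (hfu : Represents f u) : QuasiEverywhere p fun x => x ∈ A → 1 ≤ f x := by
  have hall := quasiEverywhere_all_nat hp1 hp hΩ fun n =>
    quasiEverywhere_sub_le_of_mem_closure hp1 hp hΩ hu hf hfu (Nat.one_div_pos_of_nat (n := n))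
  refine hall.mono fun x hx hxA => ?_
  have hlim : Tendsto (fun n : ℕ => 1 - 1 / ((n : ℝ) + 1)) atTop (𝓝 1) := by
    simpa using (tendsto_one_div_add_atTop_nhds_zero_nat (𝕜 := ℝ)).const_sub 1
  exact le_of_tendsto' hlim fun n => hx n hxA

theorem isClosed_quasiAdmissible (hp1 : 1 < p) (hp : p < ⊤) (hΩ : IsOpen Ω)
    (A : Set (closure Ω)) : IsClosed (quasiAdmissible p A) := by
  refine isClosed_of_closure_subset fun u hu => ?_
  obtain ⟨f, hf, hfu⟩ := exists_quasiContinuous_represents hp1 hp hΩ u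
  exact ⟨f, hf, hfu, quasiEverywhere_one_le_of_mem_closure hp1 hp hΩ hu hf hfu⟩

theorem add_mem_quasiAdmissible (hp1 : 1 < p) (hp : p < ⊤) (hΩ : IsOpen Ω)
    (hu : u ∈ quasiAdmissible p A) {v : closure Ω → ℝ} {w : Tilde p Ω}
    (hv : QuasiContinuous p Ω v) (hvw : Represents v w) (hv0 : 0 ≤ v) :
    u + w ∈ quasiAdmissible p A := by
  obtain ⟨f, hf, hfu, hA⟩ := hu
  exact ⟨f + v, hf.add hp1 hp hΩ hv, hfu.add hvw,
    hA.mono fun x hx hxA => (hx hxA).trans (le_add_of_nonneg_right (hv0 x))⟩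

theorem exists_isMinOn_norm_quasiAdmissible (hp1 : 1 < p) (hp : p < ⊤) (hΩ : IsOpen Ω)
    (hA : relCap p Ω A < ⊤) :
    ∃ u ∈ quasiAdmissible p A, IsMinOn norm (quasiAdmissible p A) u :=
  have := uniformConvexSpace (Ω := Ω) hp1 hp
  exists_isMinOn_norm (convex_quasiAdmissible hp1 hp hΩ A) (isClosed_quasiAdmissible hp1 hp hΩ A)
    (quasiAdmissible_nonempty hp1 hp hΩ hA)

end Extremal

section Measure

theorem exists_regular_integral_eq_of_nonneg {X : Type*} [TopologicalSpace X] [T2Space X]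
    [LocallyCompactSpace X] [MeasurableSpace X] [BorelSpace X] {S : Submodule ℝ C_c(X, ℝ)}
    {L : S →ₗ[ℝ] ℝ} (hL : ∀ v : S, 0 ≤ v.1 → 0 ≤ L v)
    (hS : ∀ v : C_c(X, ℝ), ∃ w ∈ S, v ≤ w) :
    ∃ μ : Measure X, μ.Regular ∧ ∀ v : S, ∫ x, v.1 x ∂μ = L v := by
  have : PosSMulMono ℝ C_c(X, ℝ) :=
    ⟨fun c hc a b hab x => mul_le_mul_of_nonneg_left (hab x) hc⟩
  obtain ⟨g, hgL, hg⟩ := riesz_extension (PointedCone.positive ℝ C_c(X, ℝ))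
    (⟨S, L⟩ : C_c(X, ℝ) →ₗ.[ℝ] ℝ) hL fun v => by
      obtain ⟨w, hw, hvw⟩ := hS (-v)
      exact ⟨⟨w, hw⟩, neg_le_iff_add_nonneg.1 hvw⟩
  refine ⟨RealRMK.rieszMeasure (PositiveLinearMap.mk₀ g fun v hv => hg v hv), inferInstance,
    fun v => ?_⟩
  rw [RealRMK.integral_rieszMeasure]
  exact hgL v

theorem measure_le_of_integral_le {X : Type*} [MeasurableSpace X] {μ ν : Measure X} {f : X → ℝ}
    (hμf : Integrable f μ) (hνf : Integrable f ν) {K V : Set X} (hK : MeasurableSet K)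
    (hV : MeasurableSet V) (hKμ : μ K < ⊤) (hVν : ν V < ⊤) (hKf : K.indicator 1 ≤ f)
    (hfV : f ≤ V.indicator 1) (h : ∫ x, f x ∂μ ≤ ∫ x, f x ∂ν) : μ K ≤ ν V := by
  rw [← ENNReal.toReal_le_toReal hKμ.ne hVν.ne]
  calc μ.real K = ∫ x, K.indicator 1 x ∂μ := (integral_indicator_one hK).symm
    _ ≤ ∫ x, f x ∂μ := integral_mono
      ((integrable_indicator_iff hK).2 (integrableOn_const hKμ.ne)) hμf hKf
    _ ≤ ∫ x, f x ∂ν := h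
    _ ≤ ∫ x, V.indicator 1 x ∂ν := integral_mono hνf
      ((integrable_indicator_iff hV).2 (integrableOn_const hVν.ne)) hfV
    _ = ν.real V := integral_indicator_one hV

variable {X : Type*} [TopologicalSpace X] [T2Space X] [MeasurableSpace X] [BorelSpace X]
  {μ ν : Measure X}

theorem measure_le_of_forall_exists_integral_le [IsFiniteMeasureOnCompacts μ]
    [IsFiniteMeasureOnCompacts ν] [ν.OuterRegular] {K : Set X} (hK : IsCompact K)
    (h : ∀ V, IsOpen V → K ⊆ V → ∃ f : C_c(X, ℝ), K.indicator 1 ≤ ⇑f ∧ ⇑f ≤ V.indicator 1 ∧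
      ∫ x, f x ∂μ ≤ ∫ x, f x ∂ν) : μ K ≤ ν K := by
  refine le_of_forall_gt fun r hr => ?_
  obtain ⟨V, hKV, hV, hVr⟩ := K.exists_isOpen_lt_of_lt r hr
  obtain ⟨f, hKf, hfV, hf⟩ := h V hV hKV
  exact (measure_le_of_integral_le
    (f.continuous.integrable_of_hasCompactSupport f.hasCompactSupport)
    (f.continuous.integrable_of_hasCompactSupport f.hasCompactSupport) hK.measurableSet
    hV.measurableSet hK.measure_lt_top hVr.lt_top hKf hfV hf).trans_lt hVr

theorem measure_eq_of_forall_exists_integral_eq [μ.Regular] [ν.Regular]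
    (h : ∀ K V : Set X, IsCompact K → IsOpen V → K ⊆ V →
      ∃ f : C_c(X, ℝ), K.indicator 1 ≤ ⇑f ∧ ⇑f ≤ V.indicator 1 ∧ ∫ x, f x ∂μ = ∫ x, f x ∂ν) :
    μ = ν := by
  refine Measure.OuterRegular.ext_isOpen fun V hV => ?_
  rw [hV.measure_eq_iSup_isCompact, hV.measure_eq_iSup_isCompact]
  refine iSup_congr fun K => iSup_congr fun _ => iSup_congr fun hK => le_antisymm ?_ ?_ <;>
  refine measure_le_of_forall_exists_integral_le hK fun W hW hKW => ?_ <;>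
  obtain ⟨f, hKf, hfW, hf⟩ := h K W hK hW hKW
  exacts [⟨f, hKf, hfW, hf.le⟩, ⟨f, hKf, hfW, hf.ge⟩]

end Measure

section Radon

variable {N : ℕ} {p : ℝ≥0∞} [Fact (1 ≤ p)] {Ω : Set (EuclideanSpace ℝ (Fin N))}

theorem isRadon_iff_regular {μ : Measure (closure Ω)} : IsRadon μ ↔ μ.Regular := by
  have : LocallyCompactSpace (closure Ω) := isClosed_closure.locallyCompactSpace
  exact ⟨fun ⟨_, _⟩ => inferInstance, fun _ => ⟨inferInstance, inferInstance⟩⟩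

/-- The space `W^{1,p}(Ω) ∩ C_c(closure Ω)`, as a space of functions on `closure Ω`. -/
def compactlySupportedSobolev (p : ℝ≥0∞) [Fact (1 ≤ p)] (Ω : Set (EuclideanSpace ℝ (Fin N))) :
    Submodule ℝ C_c(closure Ω, ℝ) where
  carrier := {v | ∃ u : Tilde p Ω, Represents v u}
  zero_mem' := ⟨0, agreesOn_zero⟩
  add_mem' := fun ⟨u, hu⟩ ⟨w, hw⟩ => ⟨u + w, hu.add hw⟩
  smul_mem' := fun c _ ⟨u, hu⟩ => ⟨c • u, hu.smul c⟩

theorem exists_linearMap_represents (p : ℝ≥0∞) [Fact (1 ≤ p)] (hΩ : IsOpen Ω) :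
    ∃ T : compactlySupportedSobolev p Ω →ₗ[ℝ] Tilde p Ω, ∀ v, Represents v.1 (T v) := by
  choose T hT using fun v : compactlySupportedSobolev p Ω => v.2
  exact ⟨{ toFun := T
           map_add' := fun v w => (hT (v + w)).unique hΩ ((hT v).add (hT w))
           map_smul' := fun c v => (hT (c • v)).unique hΩ ((hT v).smul c) }, hT⟩

theorem exists_mem_compactlySupportedSobolev_ge (p : ℝ≥0∞) [Fact (1 ≤ p)]
    (v : C_c(closure Ω, ℝ)) : ∃ w ∈ compactlySupportedSobolev p Ω, v ≤ w := by
  obtain ⟨χ, u, hu, hχ0, hχ1⟩ := exists_cutoff p v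
  obtain ⟨C, hC⟩ := v.continuous.bounded_above_of_compact_support v.hasCompactSupport
  refine ⟨C • χ, ⟨C • u, hu.smul C⟩, fun x => ?_⟩
  change v x ≤ C * χ x
  by_cases hx : v x = 0
  · rw [hx]
    exact mul_nonneg ((norm_nonneg _).trans (hC x)) (hχ0 x)
  · rw [hχ1 x hx, mul_one]
    exact (le_abs_self _).trans (hC x)

theorem exists_isRadon_integral_eq_of_nonneg (hΩ : IsOpen Ω) {Φ : StrongDual ℝ (Tilde p Ω)}
    (hΦ : ∀ (v : C_c(closure Ω, ℝ)) (u : Tilde p Ω), Represents v u → 0 ≤ v → 0 ≤ Φ u) :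
    ∃ μ : Measure (closure Ω), IsRadon μ ∧
      ∀ (v : C_c(closure Ω, ℝ)) (u : Tilde p Ω), Represents v u → Φ u = ∫ x, v x ∂μ := by
  have : LocallyCompactSpace (closure Ω) := isClosed_closure.locallyCompactSpace
  obtain ⟨T, hT⟩ := exists_linearMap_represents p hΩ
  obtain ⟨μ, hμ, hint⟩ := exists_regular_integral_eq_of_nonneg
    (L := Φ.toLinearMap ∘ₗ T) (fun v hv => hΦ v.1 (T v) (hT v) hv)
    (exists_mem_compactlySupportedSobolev_ge p)
  refine ⟨μ, isRadon_iff_regular.2 hμ, fun v u hvu => ?_⟩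
  calc Φ u = Φ (T ⟨v, u, hvu⟩) := congrArg Φ (hvu.unique hΩ (hT ⟨v, u, hvu⟩))
    _ = ∫ x, v x ∂μ := (hint ⟨v, u, hvu⟩).symm

theorem IsRadon.eq_of_integral_eq {μ ν : Measure (closure Ω)} (hμ : IsRadon μ) (hν : IsRadon ν)
    (h : ∀ (v : C_c(closure Ω, ℝ)) (u : Tilde p Ω), Represents v u →
      ∫ x, v x ∂μ = ∫ x, v x ∂ν) : μ = ν := by
  have := isRadon_iff_regular.1 hμ
  have := isRadon_iff_regular.1 hν
  refine measure_eq_of_forall_exists_integral_eq fun K V hK hV hKV => ?_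
  obtain ⟨χ, u, hu, hKχ, hχV⟩ := exists_represents_indicator_le_le_indicator p hK hV hKV
  exact ⟨χ, hKχ, hχV, h χ u hu⟩

end Radon

section CapMeasure

variable {N : ℕ} {p : ℝ≥0∞} [Fact (1 ≤ p)] {Ω : Set (EuclideanSpace ℝ (Fin N))}

/-- `Refined.toTilde` with values in `Tilde p Ω`. -/
noncomputable def Refined.tilde (c : Refined p Ω) : Tilde p Ω := c.toTilde

/-- An element of the dual of the refined Sobolev space as a functional on `Tilde p Ω`. -/
def RefinedDual.tilde (Φ : RefinedDual p Ω) : StrongDual ℝ (Tilde p Ω) := Φ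

theorem Refined.quasiContinuous (c : Refined p Ω) {f : closure Ω → ℝ} (hf : f ∈ c.1) :
    QuasiContinuous p Ω f := by
  obtain ⟨_, _, _, _, _, rfl⟩ := c
  exact hf.1

theorem Refined.exists_tilde_eq (hp1 : 1 < p) (hp : p < ⊤) (hΩ : IsOpen Ω) (u : Tilde p Ω) :
    ∃ c : Refined p Ω, c.tilde = u := by
  obtain ⟨f, hf, hfu⟩ := exists_quasiContinuous_represents hp1 hp hΩ u
  let c : Refined p Ω := ⟨quasiClass p Ω f, u, f, hf, hfu, rfl⟩
  exact ⟨c, Represents.unique hΩ (c.agreesOn hp ⟨hf, ∅, relCap_empty hp, fun _ _ => rfl⟩) hfu⟩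

theorem isPotential_iff (hp1 : 1 < p) (hp : p < ⊤) (hΩ : IsOpen Ω) {Φ : RefinedDual p Ω}
    {c : Refined p Ω} : IsPotential p Ω Φ c ↔
      IsMinOn (fun v : Tilde p Ω => 1 / p.toReal * ‖v‖ ^ p.toReal - Φ.tilde v) Set.univ
        c.tilde := by
  refine ⟨fun h v _ => ?_, fun h v => h (Set.mem_univ v.tilde)⟩
  obtain ⟨d, rfl⟩ := Refined.exists_tilde_eq hp1 hp hΩ v
  exact h d

variable {A : Set (closure Ω)} {c d : Refined p Ω}

theorem Refined.tilde_mem_quasiAdmissible_iff (hp1 : 1 < p) (hp : p < ⊤) (hΩ : IsOpen Ω) :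
    c.tilde ∈ quasiAdmissible p A ↔
      ∀ f ∈ c.1, ∃ P, relCap p Ω P = 0 ∧ ∀ x ∈ A, x ∉ P → 1 ≤ f x := by
  have hiff : ∀ f : closure Ω → ℝ, QuasiEverywhere p (fun x => x ∈ A → 1 ≤ f x) ↔
      ∃ P, relCap p Ω P = 0 ∧ ∀ x ∈ A, x ∉ P → 1 ≤ f x := fun f => by
    simp only [quasiEverywhere_iff_exists, imp.swap]
  simp only [← hiff]
  refine ⟨fun h f hf => ?_, fun h => ?_⟩
  · exact quasiEverywhere_one_le_of_mem_closure hp1 hp hΩ (subset_closure h)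
      (c.quasiContinuous hf) (c.agreesOn hp hf)
  · obtain ⟨f, hf⟩ := c.nonempty hp
    exact ⟨f, c.quasiContinuous hf, c.agreesOn hp hf, h f hf⟩

theorem isExtremal_iff (hp1 : 1 < p) (hp : p < ⊤) (hΩ : IsOpen Ω) :
    IsExtremal p Ω A c ↔
      c.tilde ∈ quasiAdmissible p A ∧ IsMinOn norm (quasiAdmissible p A) c.tilde := by
  rw [IsExtremal, ← Refined.tilde_mem_quasiAdmissible_iff hp1 hp hΩ]
  exact and_congr_right fun h => (isMinOn_norm_quasiAdmissible_iff hp1 hp hΩ h).symm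

theorem IsExtremal.tilde_eq (hp1 : 1 < p) (hp : p < ⊤) (hΩ : IsOpen Ω)
    (hc : IsExtremal p Ω A c) (hd : IsExtremal p Ω A d) : c.tilde = d.tilde := by
  have := Tilde.uniformConvexSpace (Ω := Ω) hp1 hp
  obtain ⟨hcA, hcmin⟩ := (isExtremal_iff hp1 hp hΩ).1 hc
  obtain ⟨hdA, hdmin⟩ := (isExtremal_iff hp1 hp hΩ).1 hd
  exact eq_of_isMinOn_norm_of_convex (convex_quasiAdmissible hp1 hp hΩ A) hcA hdA hcmin hdmin

theorem exists_isExtremal (hp1 : 1 < p) (hp : p < ⊤) (hΩ : IsOpen Ω)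
    (hA : relCap p Ω A < ⊤) : ∃ c : Refined p Ω, IsExtremal p Ω A c := by
  obtain ⟨u, hu⟩ := exists_isMinOn_norm_quasiAdmissible hp1 hp hΩ hA
  obtain ⟨c, rfl⟩ := Refined.exists_tilde_eq hp1 hp hΩ u
  exact ⟨c, (isExtremal_iff hp1 hp hΩ).2 hu⟩

theorem IsExtremal.apply_nonneg_of_isPotential (hp1 : 1 < p) (hp : p < ⊤) (hΩ : IsOpen Ω)
    (hc : IsExtremal p Ω A c) {Φ : RefinedDual p Ω} (hΦ : IsPotential p Ω Φ c)
    {v : closure Ω → ℝ} {w : Tilde p Ω} (hv : QuasiContinuous p Ω v) (hvw : Represents v w)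
    (hv0 : 0 ≤ v) : 0 ≤ Φ.tilde w := by
  obtain ⟨hcA, hmin⟩ := (isExtremal_iff hp1 hp hΩ).1 hc
  refine apply_nonneg_of_isMinOn (zero_lt_one.trans (one_lt_toReal hp1 hp))
    ((isPotential_iff hp1 hp hΩ).1 hΦ) (Tilde.lineDifferentiableAt_rpow_norm hp1 hp _ _)
    fun t ht => hmin ?_
  exact add_mem_quasiAdmissible hp1 hp hΩ hcA (hv.smul t) (hvw.smul t) (smul_nonneg ht hv0)

variable {μ ν : Measure (closure Ω)}

theorem IsExtension.belongsToDual {Φ : RefinedDual p Ω} (h : IsExtension μ Φ) :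
    BelongsToDual p Ω μ := by
  refine ⟨‖Φ.tilde‖, ?_⟩
  rintro _ ⟨v, w, hvw, hw, rfl⟩
  obtain ⟨u, hu, huw⟩ := hvw.exists_represents
  rw [← h v u hu]
  exact (le_abs_self _).trans (Φ.tilde.unit_le_opNorm u (huw.trans_le hw))

theorem isExtension_toDual (hΩ : IsOpen Ω) (hμ : IsRadon μ) (hd : BelongsToDual p Ω μ) :
    IsExtension μ (toDual p Ω μ) := by
  have h := (existsUnique_isExtension hΩ hμ hd).exists
  rw [toDual, dif_pos h]
  exact h.choose_spec

theorem IsExtension.toDual_eq (hΩ : IsOpen Ω) (hμ : IsRadon μ) {Φ : RefinedDual p Ω}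
    (h : IsExtension μ Φ) : toDual p Ω μ = Φ :=
  (existsUnique_isExtension hΩ hμ h.belongsToDual).unique
    (isExtension_toDual hΩ hμ h.belongsToDual) h

theorem exists_isCapMeasure (hp1 : 1 < p) (hp : p < ⊤) (hΩ : IsOpen Ω)
    (hA : relCap p Ω A < ⊤) : ∃ μ : Measure (closure Ω), IsCapMeasure p Ω A μ := by
  obtain ⟨c, hc⟩ := exists_isExtremal hp1 hp hΩ hA
  obtain ⟨Φ, hΦ⟩ := exists_isMinOn_norm_rpow_sub (one_lt_toReal hp1 hp) c.tilde
  have hpot : IsPotential p Ω Φ c := (isPotential_iff hp1 hp hΩ).2 hΦ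
  obtain ⟨μ, hμ, hext⟩ := exists_isRadon_integral_eq_of_nonneg hΩ fun v w hvw hv0 =>
    hc.apply_nonneg_of_isPotential hp1 hp hΩ hpot (quasiContinuous_of_continuous hp v.continuous)
      hvw hv0
  have hextΦ : IsExtension (p := p) μ Φ := hext
  refine ⟨μ, hμ, hextΦ.belongsToDual, c, ?_, hc⟩
  rwa [hextΦ.toDual_eq hΩ hμ]

namespace IsCapMeasure

theorem isMinOn_toDual (hp1 : 1 < p) (hp : p < ⊤) (hΩ : IsOpen Ω) (hμ : IsCapMeasure p Ω A μ)
    (hc : IsExtremal p Ω A c) :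
    IsMinOn (fun v : Tilde p Ω => 1 / p.toReal * ‖v‖ ^ p.toReal - (toDual p Ω μ).tilde v)
      Set.univ c.tilde := by
  obtain ⟨-, -, d, hd, hdA⟩ := hμ
  rw [hc.tilde_eq hp1 hp hΩ hdA]
  exact (isPotential_iff hp1 hp hΩ).1 hd

theorem unique (hp1 : 1 < p) (hp : p < ⊤) (hΩ : IsOpen Ω) (hμ : IsCapMeasure p Ω A μ)
    (hν : IsCapMeasure p Ω A ν) : μ = ν := by
  obtain ⟨c, -, hc⟩ := hμ.2.2
  have hdual : (toDual p Ω μ).tilde = (toDual p Ω ν).tilde :=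
    eq_of_isMinOn_norm_rpow_sub (zero_lt_one.trans (one_lt_toReal hp1 hp)).ne'
      (Tilde.lineDifferentiableAt_rpow_norm hp1 hp c.tilde)
      (hμ.isMinOn_toDual hp1 hp hΩ hc) (hν.isMinOn_toDual hp1 hp hΩ hc)
  refine hμ.1.eq_of_integral_eq (p := p) hν.1 fun v w hvw => ?_
  calc ∫ x, v x ∂μ = (toDual p Ω μ).tilde w := (isExtension_toDual hΩ hμ.1 hμ.2.1 v w hvw).symm
    _ = (toDual p Ω ν).tilde w := by rw [hdual]
    _ = ∫ x, v x ∂ν := isExtension_toDual hΩ hν.1 hν.2.1 v w hvw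

theorem toDual_apply_eq (hp1 : 1 < p) (hp : p < ⊤) (hΩ : IsOpen Ω) (hμ : IsCapMeasure p Ω A μ)
    (hc : IsExtremal p Ω A c) : toDual p Ω μ c.toTilde = ‖c‖ ^ p.toReal :=
  apply_self_of_isMinOn (E := Tilde p Ω) (zero_lt_one.trans (one_lt_toReal hp1 hp)).ne'
    (hμ.isMinOn_toDual hp1 hp hΩ hc)

theorem energy_eq (hp1 : 1 < p) (hp : p < ⊤) (hΩ : IsOpen Ω) (hμ : IsCapMeasure p Ω A μ)
    (hc : IsExtremal p Ω A c) : energy p Ω μ = ‖c‖ ^ p.toReal :=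
  norm_rpow_conjExponent_of_isMinOn (E := Tilde p Ω) (one_lt_toReal hp1 hp)
    (hμ.isMinOn_toDual hp1 hp hΩ hc)

end IsCapMeasure

end CapMeasure

end RelCap

theorem mainTheorem7 {N : ℕ} (p : ENNReal) [Fact (1 ≤ p)] (hp1 : 1 < p) (hp : p < ⊤)
    (Ω : Set (EuclideanSpace ℝ (Fin N))) (hΩ : IsOpen Ω) (hne : Ω.Nonempty)
    (A : Set (closure Ω)) (hA : RelCap.relCap p Ω A < ⊤) :
    (∃! μ : MeasureTheory.Measure (closure Ω), RelCap.IsCapMeasure p Ω A μ) ∧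
    ∀ μ : MeasureTheory.Measure (closure Ω), RelCap.IsCapMeasure p Ω A μ →
      ∀ u : RelCap.Refined p Ω, RelCap.IsExtremal p Ω A u →
        RelCap.relCap p Ω A = ENNReal.ofReal (‖u‖ ^ p.toReal) ∧
        ‖u‖ ^ p.toReal = RelCap.toDual p Ω μ u.toTilde ∧
        RelCap.toDual p Ω μ u.toTilde = RelCap.energy p Ω μ := by
  obtain ⟨μ, hμ⟩ := RelCap.exists_isCapMeasure hp1 hp hΩ hA
  refine ⟨⟨μ, hμ, fun ν hν => hν.unique hp1 hp hΩ hμ⟩, fun ν hν u hu => ⟨hu.2.symm, ?_, ?_⟩⟩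
  · exact (hν.toDual_apply_eq hp1 hp hΩ hu).symm
  · exact (hν.toDual_apply_eq hp1 hp hΩ hu).trans (hν.energy_eq hp1 hp hΩ hu).symm
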